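/- Let $p$ be an odd prime and let $d,r,m,j$ be positive integers with $(r,dp)=1$, $(\varphi(r),p)=1$ and $j+m\le p-1$. Dirichlet characters take values in $\mathbb{C}_p$; a congruence $x\equiv y \pmod{p^j}$ means that $(x-y)/p^j$ lies in the ring of integers of $\mathbb{C}_p$. For a Dirichlet character $\chi$ modulo $f$, the numbers $B_{n,\chi}$ are defined by $\sum_{a=1}^{f}\frac{\chi(a)ze^{az}}{e^{fz}-1}=\sum_{n\ge0}B_{n,\chi}\frac{z^n}{n!}$. For a primitive character $\chi$ and positive integers $m',k$ with $m'<p-1$ put $$B_p(m',k;\chi)=\sum_{i=1}^{k}(-1)^i\binom{k}{i}\frac{B_{i(p-1)+1-m',\chi}}{i(p-1)+1-m'} .$$ For a primitive character $\psi$ of conductor $f_\psi\mid r$ put $d(\psi,r,n)=\prod_{q\mid r/f_\psi,\ q\text{ prime}}(1-\psi(q)q^{n})$, let $\overline\psi=\psi^{-1}$, and let $\mathbf 1$ be the trivial primitive character. Let $\log_p(1+s)=\sum_{n\ge1}(-1)^{n+1}s^n/n$ for $s\in p\mathbb{Z}_p$. If $m=1$, then $$\sum_{\substack{1\le k\le[dp/r]\\(k,p)=1}}\frac1k\equiv-\frac{r}{\varphi(r)}\sum_{\substack{0\le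 n\le j-1,\ f_\psi\mid r\\(\psi,n)\ne(\mathbf 1,0)}}\overline\psi(-dp)\,d(\psi,r,-1-n)\,B_p(1+n,j-n;\psi)(-dp)^n-\frac1p\Big(\log_p r^{p-1}+\sum_{\substack{q\mid r\\ q\text{ prime}}}\frac{\log_p q^{p-1}}{q-1}\Big)\pmod{p^j}.$$ If $m>1$, then $$\sum_{\substack{1\le k\le[dp/r]\\(k,p)=1}}\frac1{k^m}\equiv-\frac{r^m}{\varphi(r)}\sum_{f_\psi\mid r}\overline\psi(-dp)\sum_{n=0}^{j-1}\binom{-m}{n}d(\psi,r,-m-n)\,B_p(m+n,j-n;\psi)(dp)^n+B_p(m,j;\mathbf 1)\pmod{p^j}.$$ Here $\psi$ runs over the primitive Dirichlet characters whose conductor $f_\psi$ divides $r$. Both congruences remain valid if any selection of the quantities $B_p(m',k;\chi)$ occurring in them is replaced by the corresponding $$-\frac{B_{p^{k-1}(p-1)+1-m',\chi}}{p^{k-1}(p-1)+1-m'} .$$ -/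

import Mathlib

noncomputable section

/-- The generalized Bernoulli number `B_{n,χ}` of a Dirichlet character `χ` modulo `f ≥ 1`,
`B_{n,χ} = f ^ (n - 1) * ∑_{a = 1}^{f} χ(a) B_n(a / f)`. The lemma
`genBernoulli_generating_function` below shows that these are the numbers defined by
`∑_{a = 1}^{f} χ(a) z e^{az} / (e^{fz} - 1) = ∑_n B_{n,χ} z^n / n!`. -/
def genBernoulli {K : Type*} [Field K] [CharZero K] (n : ℕ) {f : ℕ}
    (χ : DirichletCharacter K f) : K :=
  (f : K) ^ ((n : ℤ) - 1) *
    ∑ a ∈ Finset.Icc 1 f, χ (a : ZMod f) *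
      Polynomial.aeval ((a : K) / (f : K)) (Polynomial.bernoulli n)

theorem genBernoulli_generating_function {K : Type*} [Field K] [CharZero K] {f : ℕ} (hf : f ≠ 0)
    (χ : DirichletCharacter K f) :
    (PowerSeries.mk fun n => genBernoulli n χ / (n.factorial : K)) *
        (PowerSeries.rescale (f : K) (PowerSeries.exp K) - 1) =
      ∑ a ∈ Finset.Icc 1 f, PowerSeries.C (χ (a : ZMod f)) *
        (PowerSeries.X * PowerSeries.rescale (a : K) (PowerSeries.exp K)) := by
  have hfK : (f : K) ≠ 0 := Nat.cast_ne_zero.mpr hf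
  have key : ∀ a : ℕ,
      (PowerSeries.mk fun n => (f : K) ^ ((n : ℤ) - 1) *
          Polynomial.aeval ((a : K) / (f : K)) (Polynomial.bernoulli n) / (n.factorial : K)) *
        (PowerSeries.rescale (f : K) (PowerSeries.exp K) - 1) =
      PowerSeries.X * PowerSeries.rescale (a : K) (PowerSeries.exp K) := by
    intro a
    have h := congrArg (PowerSeries.rescale (f : K))
      (Polynomial.bernoulli_generating_function ((a : K) / (f : K)))
    rw [map_mul, map_mul, map_sub, map_one, PowerSeries.rescale_rescale,
      PowerSeries.rescale_X] at h
    rw [div_mul_cancel₀ _ hfK] at h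
    have h2 := congrArg (fun g => PowerSeries.C (f : K)⁻¹ * g) h
    simp only [← mul_assoc, ← map_mul, inv_mul_cancel₀ hfK, map_one, one_mul] at h2
    rw [← h2]
    congr 1
    ext n
    rw [PowerSeries.coeff_C_mul, PowerSeries.coeff_rescale, PowerSeries.coeff_mk,
      PowerSeries.coeff_mk, zpow_sub_one₀ hfK, zpow_natCast, map_smul, Algebra.smul_def]
    simp
    ring
  rw [← Finset.sum_congr rfl fun (a : ℕ) _ =>
    congrArg (fun g => PowerSeries.C (χ (a : ZMod f)) * g) (key a)]
  simp only [← mul_assoc]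
  rw [← Finset.sum_mul]
  congr 1
  ext n
  simp only [map_sum, PowerSeries.coeff_C_mul, PowerSeries.coeff_mk, genBernoulli,
    Finset.mul_sum, Finset.sum_div]
  exact Finset.sum_congr rfl fun a _ => by ring

/-- The `p`-adic logarithm `log_p(1 + s) = ∑_{n ≥ 1} (-1)^(n+1) s^n / n`, for `|s| < 1`. -/
def padicLog (p : ℕ) [Fact p.Prime] (x : ℚ_[p]) : ℚ_[p] :=
  ∑' n : ℕ, (-1) ^ n * (x - 1) ^ (n + 1) / ((n : ℚ_[p]) + 1)

/-- The quantity `B_p(m, k; χ)`, used for `1 ≤ m < p - 1`. -/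
def bernoulliB (p : ℕ) [Fact p.Prime] (m k : ℕ) {f : ℕ} (χ : DirichletCharacter ℂ_[p] f) :
    ℂ_[p] :=
  ∑ i ∈ Finset.Icc 1 k, (-1) ^ i * (k.choose i : ℂ_[p]) *
    (genBernoulli (i * (p - 1) + 1 - m) χ / ((i * (p - 1) + 1 - m : ℕ) : ℂ_[p]))

/-- The quantity `- B_{p^(k-1) (p-1) + 1 - m, χ} / (p^(k-1) (p-1) + 1 - m)`, used for
`1 ≤ m < p - 1` and `k ≥ 1`. -/
def bernoulliK (p : ℕ) [Fact p.Prime] (m k : ℕ) {f : ℕ} (χ : DirichletCharacter ℂ_[p] f) :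
    ℂ_[p] :=
  -(genBernoulli (p ^ (k - 1) * (p - 1) + 1 - m) χ /
    ((p ^ (k - 1) * (p - 1) + 1 - m : ℕ) : ℂ_[p]))

/-- `d(ψ, r, n) = ∏_{q ∣ r / f, q prime} (1 - ψ(q) q ^ n)` for `ψ` primitive of conductor `f`
dividing `r`. -/
def eulerD {K : Type*} [Field K] {f : ℕ} (ψ : DirichletCharacter K f) (r : ℕ) (n : ℤ) : K :=
  ∏ q ∈ (r / f).primeFactors, (1 - ψ (q : ZMod f) * (q : K) ^ n)

/-- `∑_{1 ≤ k ≤ [dp/r], (k,p) = 1} 1 / k ^ m`. -/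
def lehmerSum (p : ℕ) [Fact p.Prime] (d r m : ℕ) : ℂ_[p] :=
  ∑ k ∈ Finset.Icc 1 (d * p / r) with k.Coprime p, 1 / (k : ℂ_[p]) ^ m

/-- Congruence modulo `p ^ j` in `ℂ_[p]`: the difference is `p ^ j` times an element of the
ring of integers. -/
def CongrModPow (p : ℕ) [Fact p.Prime] (j : ℕ) (x y : ℂ_[p]) : Prop :=
  ∃ z ∈ 𝓞_ℂ_[p], x - y = (p : ℂ_[p]) ^ j * z

open Classical in
/-- The right-hand side for `m = 1`, with `X n f ψ` in the place of `B_p(1 + n, j - n; ψ)`.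
Here `f` runs over the divisors of `r` and `ψ` over the primitive characters of conductor `f`. -/
def lehmerRhsOne (p : ℕ) [Fact p.Prime] (d r j : ℕ)
    (X : ℕ → (f : ℕ) → DirichletCharacter ℂ_[p] f → ℂ_[p]) : ℂ_[p] :=
  -((r : ℂ_[p]) / (r.totient : ℂ_[p])) *
      (∑ n ∈ Finset.range j, ∑ f ∈ r.divisors,
        ∑ ψ : DirichletCharacter ℂ_[p] f with ψ.IsPrimitive ∧ ¬(ψ = 1 ∧ n = 0),
          ψ⁻¹ (-((d * p : ℕ) : ZMod f)) * eulerD ψ r (-1 - (n : ℤ)) * X n f ψ *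
            (-((d * p : ℕ) : ℂ_[p])) ^ n)
    - algebraMap ℚ_[p] ℂ_[p] (1 / (p : ℚ_[p]) *
        (padicLog p ((r : ℚ_[p]) ^ (p - 1)) +
          ∑ q ∈ r.primeFactors, padicLog p ((q : ℚ_[p]) ^ (p - 1)) / ((q : ℚ_[p]) - 1)))

open Classical in
/-- The right-hand side for `m > 1`, with `X n f ψ` in the place of `B_p(m + n, j - n; ψ)` in the
sum, and `X₀` in the place of the separate term `B_p(m, j; 1)`. -/
def lehmerRhs (p : ℕ) [Fact p.Prime] (d r m j : ℕ) (X₀ : ℂ_[p])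
    (X : ℕ → (f : ℕ) → DirichletCharacter ℂ_[p] f → ℂ_[p]) : ℂ_[p] :=
  -((r : ℂ_[p]) ^ m / (r.totient : ℂ_[p])) *
      (∑ f ∈ r.divisors, ∑ ψ : DirichletCharacter ℂ_[p] f with ψ.IsPrimitive,
        ψ⁻¹ (-((d * p : ℕ) : ZMod f)) *
          ∑ n ∈ Finset.range j, ((Ring.choose (-(m : ℤ)) n : ℤ) : ℂ_[p]) *
            eulerD ψ r (-(m : ℤ) - (n : ℤ)) * X n f ψ * ((d * p : ℕ) : ℂ_[p]) ^ n)
    + X₀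

end

/-!
Write `N = d p`. The proof compares negative powers with positive ones and interpolates `p`-adically.

For `k` prime to `p`, expanding `k ^ (-m) (1 - k ^ (p - 1)) ^ j ≡ 0` modulo `p ^ j` turns the sum of
`k ^ (-m)` into an alternating binomial sum over `1 ≤ i ≤ j` of the power sums with the positive
exponents `s = i (p - 1) - m` (`lehmerSum_add_mem`). By orthogonality of the characters modulo `r`,
such a power sum is a combination of the values at `N` of the Bernoulli polynomials attached to
these characters (`sum_pow_div_eq`). Passing to primitive characters produces the factors `eulerD`,
and modulo `p ^ j` only the powers `N ^ n` with `n < j` survive (`sum_pow_sub_mem`).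

For a nontrivial character `χ` of conductor prime to `p`, the numbers `B_{t+1,χ} / (t + 1)` are
moments `∑ w_x x ^ t` with integral weights, and so are the numbers
`(1 - c ^ (t + 1)) B_{t+1} / (t + 1)` for `c` prime to `p` (`exists_moments`). Along
`t = i (p - 1) - m`, such moments are, modulo a suitable power of `p`, sums of exponentials
`v z ^ i` with `z ≡ 1` modulo `p` (`ExpCongr`). These extend to `i = 0`, and their alternating
binomial sums over `i ≥ 1` are the negative of the value at `i = 0`. Both `B_p(m, k; χ)` and the
single Bernoulli quotient that may replace it are the negative of that value modulo `p ^ k`. Since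
`r ^ (-s)`, the Euler factors and, at the cost of `n` powers of `p`, the binomial coefficients
`(s choose n)` have the same kind of dependence on `i`, each alternating sum can be evaluated
(`sum_lehmerTerm_sub_mem`).

Only for `m = 1`, `n = 0` and the trivial character is there a pole at `i = 0`. There the
combined coefficient `eulerDefect` vanishes at `t = 0`, and the value of its product with `B_t / t`
is computed as the limit along `t = p ^ M (p - 1)`: the derivative of `eulerDefect` gives the
`p`-adic logarithms, and `p B_t` tends to `p - 1` (`sum_eulerDefect_sub_mem`).
-/

/-! ### The ring of integers of `ℂ_[p]` and the powers of `p` in it -/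

section Integrality

variable {p : ℕ} [Fact p.Prime]

/-- The additive group `p ^ k 𝓞` of the multiples of `p ^ k` in the ring of integers of `ℂ_[p]`,
so that `CongrModPow p k x y` says `x - y ∈ pPow p k`. -/
def pPow (p : ℕ) [Fact p.Prime] (k : ℕ) : AddSubgroup ℂ_[p] where
  carrier := {x | ∃ z ∈ 𝓞_ℂ_[p], x = (p : ℂ_[p]) ^ k * z}
  zero_mem' := ⟨0, zero_mem _, by simp⟩
  add_mem' := by
    rintro _ _ ⟨a, ha, rfl⟩ ⟨b, hb, rfl⟩
    exact ⟨a + b, add_mem ha hb, by ring⟩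
  neg_mem' := by
    rintro _ ⟨a, ha, rfl⟩
    exact ⟨-a, neg_mem ha, by ring⟩

lemma mem_pPow {k : ℕ} {x : ℂ_[p]} : x ∈ pPow p k ↔ ∃ z ∈ 𝓞_ℂ_[p], x = (p : ℂ_[p]) ^ k * z :=
  Iff.rfl

lemma natCast_prime_ne_zero : (p : ℂ_[p]) ≠ 0 := Nat.cast_ne_zero.mpr (Fact.out : p.Prime).ne_zero

lemma mem_pPow_zero {x : ℂ_[p]} : x ∈ pPow p 0 ↔ x ∈ 𝓞_ℂ_[p] := by
  simp [mem_pPow]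

lemma mul_mem_pPow_add {a b : ℕ} {x y : ℂ_[p]} (hx : x ∈ pPow p a) (hy : y ∈ pPow p b) :
    x * y ∈ pPow p (a + b) := by
  obtain ⟨u, hu, rfl⟩ := hx
  obtain ⟨v, hv, rfl⟩ := hy
  exact ⟨u * v, mul_mem hu hv, by ring⟩

lemma mul_mem_pPow {k : ℕ} {x y : ℂ_[p]} (hx : x ∈ 𝓞_ℂ_[p]) (hy : y ∈ pPow p k) :
    x * y ∈ pPow p k := by
  obtain ⟨v, hv, rfl⟩ := hy
  exact ⟨x * v, mul_mem hx hv, by ring⟩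

lemma mul_mem_pPow' {k : ℕ} {x y : ℂ_[p]} (hx : x ∈ pPow p k) (hy : y ∈ 𝓞_ℂ_[p]) :
    x * y ∈ pPow p k := by
  rw [mul_comm]; exact mul_mem_pPow hy hx

lemma pow_mem_pPow (k : ℕ) : (p : ℂ_[p]) ^ k ∈ pPow p k := ⟨1, one_mem _, by simp⟩

lemma pPow_le {a b : ℕ} (h : a ≤ b) {x : ℂ_[p]} (hx : x ∈ pPow p b) : x ∈ pPow p a := by
  obtain ⟨z, hz, rfl⟩ := hx
  refine ⟨(p : ℂ_[p]) ^ (b - a) * z, mul_mem (pow_mem (natCast_mem _ _) _) hz, ?_⟩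
  rw [← mul_assoc, ← pow_add, Nat.add_sub_cancel' h]

lemma pPow_le_int {a : ℕ} {x : ℂ_[p]} (hx : x ∈ pPow p a) : x ∈ 𝓞_ℂ_[p] :=
  mem_pPow_zero.1 (pPow_le a.zero_le hx)

lemma pow_mem_pPow_of_mem {x : ℂ_[p]} {a : ℕ} (hx : x ∈ pPow p a) (n : ℕ) :
    x ^ n ∈ pPow p (a * n) := by
  induction n with
  | zero => simpa using mem_pPow_zero.2 (one_mem _)
  | succ n ih => rw [pow_succ, Nat.mul_succ]; exact mul_mem_pPow_add ih hx

/-- Cancellation of a factor that is a unit of the ring of integers. -/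
lemma mem_pPow_of_mul {k : ℕ} {u x : ℂ_[p]} (hu0 : u ≠ 0) (hu : u⁻¹ ∈ 𝓞_ℂ_[p])
    (h : u * x ∈ pPow p k) : x ∈ pPow p k := by
  simpa [hu0] using mul_mem_pPow hu h

lemma mem_int_iff_norm {x : ℂ_[p]} : x ∈ 𝓞_ℂ_[p] ↔ ‖x‖ ≤ 1 := by
  rw [PadicComplex.norm_eq_norm, PadicComplexInt, Valuation.mem_valuationSubring_iff]
  have := Valued.toNormedField.norm_le_one_iff (L := ℂ_[p]) (x := x)
  rw [← this]
  rfl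

lemma norm_natCast_prime : ‖(p : ℂ_[p])‖ = (p : ℝ)⁻¹ := by
  rw [← map_natCast (algebraMap ℚ_[p] ℂ_[p]), norm_algebraMap', Padic.norm_p]

lemma mem_pPow_iff_norm {k : ℕ} {x : ℂ_[p]} : x ∈ pPow p k ↔ ‖x‖ ≤ (p : ℝ)⁻¹ ^ k := by
  have hp0 : (0 : ℝ) < p := Nat.cast_pos.2 (Fact.out : p.Prime).pos
  have hpk : (p : ℂ_[p]) ^ k ≠ 0 := pow_ne_zero _ natCast_prime_ne_zero
  constructor
  · rintro ⟨z, hz, rfl⟩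
    rw [norm_mul, norm_pow, norm_natCast_prime]
    exact mul_le_of_le_one_right (by positivity) (mem_int_iff_norm.1 hz)
  · intro h
    refine ⟨x / (p : ℂ_[p]) ^ k, mem_int_iff_norm.2 ?_, by field_simp⟩
    rw [norm_div, norm_pow, norm_natCast_prime]
    exact div_le_one_of_le₀ h (by positivity)

lemma algebraMap_mem_pPow_iff {k : ℕ} {x : ℚ_[p]} :
    algebraMap ℚ_[p] ℂ_[p] x ∈ pPow p k ↔ ‖x‖ ≤ (p : ℝ)⁻¹ ^ k := by
  rw [mem_pPow_iff_norm, norm_algebraMap']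

lemma norm_intCast_of_not_dvd {n : ℤ} (h : ¬ (p : ℤ) ∣ n) : ‖(n : ℂ_[p])‖ = 1 := by
  rw [← map_intCast (algebraMap ℚ_[p] ℂ_[p]), norm_algebraMap']
  exact le_antisymm (Padic.norm_int_le_one _) (not_lt.1 fun h' => h (Padic.norm_intCast_lt_one_iff |>.1 h'))

lemma inv_intCast_mem_int {n : ℤ} (h : ¬ (p : ℤ) ∣ n) : (n : ℂ_[p])⁻¹ ∈ 𝓞_ℂ_[p] := by
  rw [mem_int_iff_norm, norm_inv, norm_intCast_of_not_dvd h, inv_one]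

lemma inv_natCast_mem_int {n : ℕ} (h : ¬ p ∣ n) : (n : ℂ_[p])⁻¹ ∈ 𝓞_ℂ_[p] := by
  have := inv_intCast_mem_int (p := p) (n := n) (by exact_mod_cast h)
  simpa using this

lemma intCast_mem_pPow {n : ℤ} {k : ℕ} (h : (p : ℤ) ^ k ∣ n) : (n : ℂ_[p]) ∈ pPow p k := by
  obtain ⟨m, rfl⟩ := h
  exact ⟨m, intCast_mem _ _, by push_cast; ring⟩

lemma mem_int_of_pow_eq_one {x : ℂ_[p]} {n : ℕ} (hn : n ≠ 0) (h : x ^ n = 1) : x ∈ 𝓞_ℂ_[p] := by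
  rw [mem_int_iff_norm]
  have h1 : ‖x‖ ^ n = 1 := by rw [← norm_pow, h, norm_one]
  exact ((pow_eq_one_iff_of_nonneg (norm_nonneg x) hn).1 h1).le

lemma dirichletCharacter_mem_int {f : ℕ} [NeZero f] (χ : DirichletCharacter ℂ_[p] f) (a : ZMod f) :
    χ a ∈ 𝓞_ℂ_[p] := by
  by_cases ha : IsUnit a
  · obtain ⟨u, rfl⟩ := ha
    refine mem_int_of_pow_eq_one (Fintype.card_ne_zero (α := (ZMod f)ˣ)) ?_
    rw [← map_pow, ← Units.val_pow_eq_pow_val, pow_card_eq_one, Units.val_one, map_one]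
  · rw [χ.map_nonunit ha]; exact zero_mem _

lemma mem_int_of_sub_one_mem {z : ℂ_[p]} {k : ℕ} (hz : z - 1 ∈ pPow p k) : z ∈ 𝓞_ℂ_[p] := by
  simpa using add_mem (pPow_le_int hz) (one_mem _)

lemma mul_sub_one_mem {y z : ℂ_[p]} {k : ℕ} (hy : y - 1 ∈ pPow p k) (hz : z - 1 ∈ pPow p k) :
    y * z - 1 ∈ pPow p k := by
  have : y * z - 1 = y * (z - 1) + (y - 1) := by ring
  rw [this]
  exact add_mem (mul_mem_pPow (mem_int_of_sub_one_mem hy) hz) hy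

lemma pow_sub_one_mem {z : ℂ_[p]} {k : ℕ} (hz : z - 1 ∈ pPow p k) (n : ℕ) :
    z ^ n - 1 ∈ pPow p k := by
  induction n with
  | zero => simp
  | succ n ih => rw [pow_succ]; exact mul_sub_one_mem ih hz

/-- Raising to the `p ^ k`-th power brings a principal unit `k` steps closer to `1`. -/
lemma pow_prime_pow_sub_one_mem {z : ℂ_[p]} (hz : z - 1 ∈ pPow p 1) (k : ℕ) :
    z ^ p ^ k - 1 ∈ pPow p (k + 1) := by
  induction k with
  | zero => simpa using hz
  | succ k ih =>
    set y := z ^ p ^ k with hy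
    have h1 : z ^ p ^ (k + 1) - 1 = (y - 1) * ∑ i ∈ Finset.range p, y ^ i := by
      rw [mul_geom_sum, hy, ← pow_mul, pow_succ]
    have h2 : ∑ i ∈ Finset.range p, y ^ i = ∑ i ∈ Finset.range p, (y ^ i - 1) + p := by simp
    rw [h1]
    refine mul_mem_pPow_add ih ?_
    rw [h2]
    refine add_mem (sum_mem fun i _ => pow_sub_one_mem (pPow_le (by omega) ih) i) ?_
    simpa using pow_mem_pPow (p := p) 1

lemma natCast_pow_sub_one_mem {n : ℕ} (h : ¬ p ∣ n) : (n : ℂ_[p]) ^ (p - 1) - 1 ∈ pPow p 1 := by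
  have hp : p.Prime := Fact.out
  have h1 : (n : ℤ) ^ (p - 1) ≡ 1 [ZMOD p] :=
    Int.ModEq.pow_card_sub_one_eq_one hp
      (Int.isCoprime_iff_gcd_eq_one.2 (by simpa using ((Nat.Prime.coprime_iff_not_dvd hp).2 h).symm))
  have h2 : ((((n : ℤ) ^ (p - 1) - 1 : ℤ)) : ℂ_[p]) ∈ pPow p 1 :=
    intCast_mem_pPow (by simpa using (Int.modEq_iff_dvd.1 h1.symm))
  simpa using h2

lemma inv_natCast_pow_sub_one_mem {n : ℕ} (h : ¬ p ∣ n) :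
    (n : ℂ_[p])⁻¹ ^ (p - 1) - 1 ∈ pPow p 1 := by
  have hn : (n : ℂ_[p]) ≠ 0 := Nat.cast_ne_zero.2 (by rintro rfl; exact h (dvd_zero p))
  have h1 : (n : ℂ_[p])⁻¹ ^ (p - 1) - 1 =
      -(n : ℂ_[p])⁻¹ ^ (p - 1) * ((n : ℂ_[p]) ^ (p - 1) - 1) := by
    rw [inv_pow]
    have := pow_ne_zero (p - 1) hn
    field_simp
    ring
  rw [h1]
  exact mul_mem_pPow (neg_mem (pow_mem (inv_natCast_mem_int h) _)) (natCast_pow_sub_one_mem h)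

end Integrality

/-! ### Twisting the coefficients of a polynomial with a high order zero at `1` -/

section Twist

open Polynomial

/-- Multiplying the coefficients of `A` by the values of a polynomial `Q` of degree at most `n`
lowers the order of vanishing at `1` by at most `n`: the twist is a polynomial of degree `n` in the
operator `X d/dX` applied to `A`. -/
lemma exists_coeff_eq_eval_mul_coeff {R : Type*} [CommRing R] {A Q : R[X]} {j n : ℕ}
    (hA : (X - 1) ^ j ∣ A) (hQ : Q.natDegree ≤ n) :
    ∃ T : R[X], (X - 1) ^ (j - n) ∣ T ∧ ∀ a : ℕ, T.coeff a = Q.eval (a : R) * A.coeff a := by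
  have hD : ∀ e : ℕ, ∃ T : R[X], (X - 1) ^ (j - e) ∣ T ∧
      ∀ a : ℕ, T.coeff a = (a : R) ^ e * A.coeff a := by
    intro e
    induction e with
    | zero => exact ⟨A, by simpa using hA, by simp⟩
    | succ e ih =>
      obtain ⟨T, hT, hc⟩ := ih
      refine ⟨X * derivative T, ?_, fun a => ?_⟩
      · rw [← Nat.sub_sub]
        exact (pow_sub_one_dvd_derivative_of_pow_dvd hT).mul_left _
      · rcases a with _ | a
        · simp
        · rw [coeff_X_mul, coeff_derivative, hc]
          push_cast
          ring
  choose T hT hc using hD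
  refine ⟨∑ e ∈ Finset.range (n + 1), C (Q.coeff e) * T e, ?_, fun a => ?_⟩
  · refine Finset.dvd_sum fun e he => ?_
    have he' : e ≤ n := Finset.mem_range_succ_iff.1 he
    exact ((pow_dvd_pow _ (by omega)).trans (hT e)).mul_left _
  · rw [eval_eq_sum_range' (Nat.lt_succ_of_le hQ), finsetSum_coeff, Finset.sum_mul]
    refine Finset.sum_congr rfl fun e _ => ?_
    rw [coeff_C_mul, hc]
    ring

end Twist

/-! ### Sequences congruent to sums of exponentials of principal units -/

section ExpCongr

variable {p : ℕ} [Fact p.Prime]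

/-- `ExpCongr p J I F` says that, for `i ≤ I`, the terms `F i` are congruent modulo `p ^ J` to
`∑ l, v_l * z_l ^ i`, a finite sum with `v_l` integral and `z_l ≡ 1` modulo `p`. The values of such
an `F` at positive `i` determine `F 0` modulo `p ^ J` if `J ≤ I`, and they satisfy the Kummer
congruences. -/
inductive ExpCongr (p : ℕ) [Fact p.Prime] (J I : ℕ) : (ℕ → ℂ_[p]) → Prop
  | exp {v z : ℂ_[p]} (hv : v ∈ 𝓞_ℂ_[p]) (hz : z - 1 ∈ pPow p 1) :
      ExpCongr p J I fun i => v * z ^ i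
  | add {F G : ℕ → ℂ_[p]} (hF : ExpCongr p J I F) (hG : ExpCongr p J I G) :
      ExpCongr p J I (F + G)
  | congr {F G : ℕ → ℂ_[p]} (hF : ExpCongr p J I F) (h : ∀ i ≤ I, G i - F i ∈ pPow p J) :
      ExpCongr p J I G

namespace ExpCongr

variable {J I : ℕ} {F : ℕ → ℂ_[p]}

lemma of_mem (h : ∀ i ≤ I, F i ∈ pPow p J) : ExpCongr p J I F :=
  (exp (v := 0) (z := 1) (zero_mem _) (by simp)).congr (by simpa using h)

lemma sum {ι : Type*} (s : Finset ι) {G : ι → ℕ → ℂ_[p]} (h : ∀ x ∈ s, ExpCongr p J I (G x)) :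
    ExpCongr p J I fun i => ∑ x ∈ s, G x i := by
  classical
  induction s using Finset.induction_on with
  | empty => exact of_mem fun i _ => by simp
  | insert a s ha ih =>
    have := (h a (by simp)).add (ih fun x hx => h x (by simp [hx]))
    simpa [Finset.sum_insert ha, Pi.add_def] using this

lemma mem_int (hF : ExpCongr p J I F) {i : ℕ} (hi : i ≤ I) : F i ∈ 𝓞_ℂ_[p] := by
  induction hF with
  | exp hv hz => exact mul_mem hv (pow_mem (mem_int_of_sub_one_mem hz) _)
  | add _ _ h1 h2 => exact add_mem h1 h2
  | congr _ h h1 => simpa using add_mem (pPow_le_int (h i hi)) h1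

lemma mul_exp (hF : ExpCongr p J I F) {u y : ℂ_[p]} (hu : u ∈ 𝓞_ℂ_[p]) (hy : y - 1 ∈ pPow p 1) :
    ExpCongr p J I fun i => u * y ^ i * F i := by
  induction hF with
  | @exp v z hv hz =>
    have := exp (J := J) (I := I) (mul_mem hu hv) (mul_sub_one_mem hy hz)
    convert this using 2
    rw [mul_pow]; ring
  | add _ _ h1 h2 =>
    convert h1.add h2 using 1
    ext i
    simp only [Pi.add_apply]
    ring
  | congr _ h h1 =>
    refine h1.congr fun i hi => ?_
    rw [← mul_sub]
    exact mul_mem_pPow (mul_mem hu (pow_mem (mem_int_of_sub_one_mem hy) _)) (h i hi)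

lemma const_mul (hF : ExpCongr p J I F) {u : ℂ_[p]} (hu : u ∈ 𝓞_ℂ_[p]) :
    ExpCongr p J I fun i => u * F i := by
  simpa using hF.mul_exp hu (y := 1) (by simp)

open Polynomial in
/-- A polynomial weight of degree `n` costs at most `n` powers of `p` in the `j`-th difference. -/
lemma sum_choose_eval_mul_exp_mem {z : ℂ_[p]} (hz : z - 1 ∈ pPow p 1) {Q : ℤ[X]} {n : ℕ}
    (hQ : Q.natDegree ≤ n) (j : ℕ) :
    ∑ i ∈ Finset.range (j + 1), (-1) ^ i * (j.choose i : ℂ_[p]) * ((Q.eval (i : ℤ) : ℤ) : ℂ_[p]) *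
      z ^ i ∈ pPow p (j - n) := by
  set A : ℤ[X] := ∑ i ∈ Finset.range (j + 1), monomial i ((-1) ^ i * (j.choose i : ℤ)) with hAdef
  have hA : A = (1 - X) ^ j := by
    rw [sub_eq_add_neg, add_comm (1 : ℤ[X]), add_pow, hAdef]
    refine Finset.sum_congr rfl fun i _ => ?_
    rw [← C_mul_X_pow_eq_monomial]
    simp [neg_pow (X : ℤ[X]) i]
    ring
  have hdvd : (X - 1) ^ j ∣ A := by
    rw [hA, ← neg_sub, neg_pow]
    exact ⟨(-1) ^ j, by rw [mul_right_comm, ← mul_pow]; simp⟩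
  obtain ⟨T, ⟨S, hS⟩, hc⟩ := exists_coeff_eq_eval_mul_coeff hdvd hQ
  have hAc : ∀ i, A.coeff i = if i < j + 1 then (-1) ^ i * (j.choose i : ℤ) else 0 := by
    intro i
    rw [hAdef, finsetSum_coeff]
    simp [coeff_monomial]
  have hdeg : T.natDegree < j + 1 := by
    refine Nat.lt_succ_of_le (natDegree_le_iff_coeff_eq_zero.2 fun i hi => ?_)
    rw [hc, hAc, if_neg (by omega), mul_zero]
  have h1 := aeval_eq_sum_range' hdeg z
  have h2 : aeval z T = (z - 1) ^ (j - n) * aeval z S := by simp [hS]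
  have h3 : ∑ i ∈ Finset.range (j + 1), (-1) ^ i * (j.choose i : ℂ_[p]) *
      ((Q.eval (i : ℤ) : ℤ) : ℂ_[p]) * z ^ i = aeval z T := by
    rw [h1]
    refine Finset.sum_congr rfl fun i hi => ?_
    rw [hc, hAc, if_pos (Finset.mem_range.1 hi), zsmul_eq_mul]
    push_cast
    ring
  rw [h3, h2]
  refine mul_mem_pPow' (by simpa using pow_mem_pPow_of_mem hz (j - n)) ?_
  rw [aeval_eq_sum_range]
  exact sum_mem fun i _ => zsmul_mem (pow_mem (mem_int_of_sub_one_mem hz) _) _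

open Polynomial in
lemma sum_choose_eval_mul_mem (hF : ExpCongr p J I F) {Q : ℤ[X]} {n j : ℕ}
    (hQ : Q.natDegree ≤ n) (hj : j ≤ I) (hJ : J ≤ j - n) :
    ∑ i ∈ Finset.range (j + 1), (-1) ^ i * (j.choose i : ℂ_[p]) * ((Q.eval (i : ℤ) : ℤ) : ℂ_[p]) *
      F i ∈ pPow p J := by
  induction hF with
  | @exp v z hv hz =>
    have := mul_mem_pPow hv (pPow_le hJ (sum_choose_eval_mul_exp_mem hz hQ j))
    rw [Finset.mul_sum] at this
    convert this using 2
    ring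
  | add _ _ h1 h2 =>
    have := add_mem h1 h2
    rw [← Finset.sum_add_distrib] at this
    convert this using 2
    simp only [Pi.add_apply]
    ring
  | @congr F G _ h h1 =>
    have h3 : ∑ i ∈ Finset.range (j + 1), (-1) ^ i * (j.choose i : ℂ_[p]) *
        ((Q.eval (i : ℤ) : ℤ) : ℂ_[p]) * (G i - F i) ∈ pPow p J := by
      refine sum_mem fun i hi => mul_mem_pPow ?_ (h i (by grind))
      exact mul_mem (mul_mem (pow_mem (neg_mem (one_mem _)) _) (natCast_mem _ _)) (intCast_mem _ _)
    have := add_mem h1 h3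
    rw [← Finset.sum_add_distrib] at this
    convert this using 2
    ring

/-- The version of `sum_choose_eval_mul_mem` for a binomial coefficient whose upper entry is linear
in the summation index; its denominator `n!` is prime to `p`. -/
lemma sum_choose_ringChoose_mul_mem (hF : ExpCongr p J I F) (α β : ℤ) {n j : ℕ} (hn : n < p)
    (hj : j ≤ I) (hJ : J ≤ j - n) :
    ∑ i ∈ Finset.range (j + 1), (-1) ^ i * (j.choose i : ℂ_[p]) *
      ((Ring.choose (α * i + β) n : ℤ) : ℂ_[p]) * F i ∈ pPow p J := by
  open Polynomial in
  set Q : ℤ[X] := (descPochhammer ℤ n).comp (C α * X + C β) with hQ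
  have hdeg : Q.natDegree ≤ n := by
    rw [hQ]
    refine natDegree_comp_le.trans ?_
    rw [descPochhammer_natDegree]
    exact (Nat.mul_le_mul_left n natDegree_linear_le).trans (by simp)
  have hev : ∀ i : ℕ, Q.eval (i : ℤ) = n.factorial * Ring.choose (α * i + β) n := by
    intro i
    rw [hQ, eval_comp, eval_eq_smeval, Ring.descPochhammer_eq_factorial_smul_choose]
    simp
  have h1 := sum_choose_eval_mul_mem hF hdeg hj hJ
  refine mem_pPow_of_mul (u := (n.factorial : ℂ_[p]))
    (Nat.cast_ne_zero.2 n.factorial_ne_zero)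
    (inv_natCast_mem_int fun h => ?_) ?_
  · exact absurd (((Fact.out : p.Prime).dvd_factorial).1 h) (by omega)
  · rw [Finset.mul_sum]
    convert h1 using 2
    rw [hev]
    push_cast
    ring

lemma sum_choose_mul_mem (hF : ExpCongr p J I F) {j : ℕ} (hj : j ≤ I) (hJ : J ≤ j) :
    ∑ i ∈ Finset.range (j + 1), (-1) ^ i * (j.choose i : ℂ_[p]) * F i ∈ pPow p J := by
  simpa using hF.sum_choose_eval_mul_mem (Q := 1) (n := 0) (by simp) hj (by simpa using hJ)

lemma prime_pow_sub_zero_mem (hF : ExpCongr p J I F) {k : ℕ} (hk : p ^ k ≤ I) (hJ : J ≤ k + 1) :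
    F (p ^ k) - F 0 ∈ pPow p J := by
  induction hF with
  | @exp v z hv hz =>
    have := mul_mem_pPow hv (pPow_le hJ (pow_prime_pow_sub_one_mem hz k))
    convert this using 1
    ring
  | add _ _ h1 h2 =>
    convert add_mem h1 h2 using 1
    simp only [Pi.add_apply]
    ring
  | @congr F G _ h h1 =>
    convert add_mem (sub_mem (h _ hk) (h 0 (by omega))) h1 using 1
    ring

end ExpCongr

end ExpCongr

/-! ### Bernoulli polynomials and Bernoulli numbers of periodic functions -/

section PeriodicBernoulli

variable {K : Type*} [Field K] [CharZero K]

/-- The rescaled Bernoulli polynomial `f ^ (n - 1) * B_n(x / f)`. -/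
noncomputable def scaledBernoulli (n f : ℕ) (x : K) : K :=
  (f : K) ^ ((n : ℤ) - 1) * Polynomial.aeval (x / (f : K)) (Polynomial.bernoulli n)

/-- The Bernoulli number of a function `h` regarded as periodic modulo `f`; for a Dirichlet
character this is `genBernoulli`. -/
noncomputable def periodicBernoulli (n f : ℕ) (h : ℕ → K) : K :=
  ∑ a ∈ Finset.Icc 1 f, h a * scaledBernoulli n f (a : K)

lemma genBernoulli_eq_periodicBernoulli (n : ℕ) {f : ℕ} (χ : DirichletCharacter K f) :
    genBernoulli n χ = periodicBernoulli n f fun a => χ (a : ZMod f) := by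
  rw [genBernoulli, periodicBernoulli, Finset.mul_sum]
  exact Finset.sum_congr rfl fun a _ => by rw [scaledBernoulli]; ring

/-- The exponential generating function `z e^{xz} / (e^{fz} - 1)`. -/
lemma mk_scaledBernoulli_mul {f : ℕ} (hf : f ≠ 0) (x : K) :
    (PowerSeries.mk fun n => scaledBernoulli n f x / (n.factorial : K)) *
        (PowerSeries.rescale (f : K) (PowerSeries.exp K) - 1) =
      PowerSeries.X * PowerSeries.rescale x (PowerSeries.exp K) := by
  have hfK : (f : K) ≠ 0 := Nat.cast_ne_zero.mpr hf
  have h := congrArg (PowerSeries.rescale (f : K))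
    (Polynomial.bernoulli_generating_function (x / (f : K)))
  rw [map_mul, map_mul, map_sub, map_one, PowerSeries.rescale_rescale,
    PowerSeries.rescale_X] at h
  rw [div_mul_cancel₀ _ hfK] at h
  have h2 := congrArg (fun g => PowerSeries.C (f : K)⁻¹ * g) h
  simp only [← mul_assoc, ← map_mul, inv_mul_cancel₀ hfK, map_one, one_mul] at h2
  rw [← h2]
  congr 1
  ext n
  rw [PowerSeries.coeff_C_mul, PowerSeries.coeff_rescale, PowerSeries.coeff_mk,
    PowerSeries.coeff_mk, scaledBernoulli, zpow_sub_one₀ hfK, zpow_natCast, map_smul,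
    Algebra.smul_def]
  simp
  ring

lemma rescale_exp_sub_one_ne_zero {f : ℕ} (hf : f ≠ 0) :
    PowerSeries.rescale (f : K) (PowerSeries.exp K) - 1 ≠ 0 := by
  intro h
  have := congrArg (PowerSeries.coeff 1) h
  simp [PowerSeries.coeff_rescale, PowerSeries.coeff_exp, PowerSeries.coeff_one] at this
  exact hf this

/-- Two sequences agree if their exponential generating functions agree after multiplication by
`e^{fz} - 1`. -/
lemma eq_of_mk_mul_eq {f : ℕ} (hf : f ≠ 0) {u v : ℕ → K}
    (h : (PowerSeries.mk fun n => u n / (n.factorial : K)) *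
        (PowerSeries.rescale (f : K) (PowerSeries.exp K) - 1) =
      (PowerSeries.mk fun n => v n / (n.factorial : K)) *
        (PowerSeries.rescale (f : K) (PowerSeries.exp K) - 1)) (n : ℕ) : u n = v n := by
  have h1 := mul_right_cancel₀ (rescale_exp_sub_one_ne_zero hf) h
  have h2 := congrArg (PowerSeries.coeff n) h1
  simp only [PowerSeries.coeff_mk] at h2
  have : (n.factorial : K) ≠ 0 := Nat.cast_ne_zero.2 n.factorial_ne_zero
  field_simp at h2
  exact h2

/-- The Taylor expansion of the Bernoulli polynomials. -/
lemma scaledBernoulli_add {f : ℕ} (hf : f ≠ 0) (n : ℕ) (x y : K) :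
    scaledBernoulli n f (x + y) =
      ∑ k ∈ Finset.range (n + 1), (n.choose k : K) * y ^ k * scaledBernoulli (n - k) f x := by
  refine eq_of_mk_mul_eq hf (u := fun n => scaledBernoulli n f (x + y)) (v := fun n =>
    ∑ k ∈ Finset.range (n + 1), (n.choose k : K) * y ^ k * scaledBernoulli (n - k) f x) ?_ n
  have h : (PowerSeries.mk fun n => (∑ k ∈ Finset.range (n + 1),
      (n.choose k : K) * y ^ k * scaledBernoulli (n - k) f x) / (n.factorial : K)) =
      PowerSeries.rescale y (PowerSeries.exp K) *
        PowerSeries.mk fun n => scaledBernoulli n f x / (n.factorial : K) := by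
    ext n
    rw [PowerSeries.coeff_mul, Finset.Nat.sum_antidiagonal_eq_sum_range_succ_mk,
      PowerSeries.coeff_mk, Finset.sum_div]
    refine Finset.sum_congr rfl fun k hk => ?_
    have hk' : k ≤ n := Finset.mem_range_succ_iff.1 hk
    rw [PowerSeries.coeff_rescale, PowerSeries.coeff_exp, PowerSeries.coeff_mk,
      Nat.cast_choose K hk']
    have h1 : (n.factorial : K) ≠ 0 := Nat.cast_ne_zero.2 n.factorial_ne_zero
    have h2 : (k.factorial : K) ≠ 0 := Nat.cast_ne_zero.2 k.factorial_ne_zero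
    have h3 : ((n - k).factorial : K) ≠ 0 := Nat.cast_ne_zero.2 (n - k).factorial_ne_zero
    simp only [map_div₀, map_one, map_natCast]
    field_simp
  rw [h, mul_assoc, mk_scaledBernoulli_mul hf, mk_scaledBernoulli_mul hf,
    ← PowerSeries.exp_mul_exp_eq_exp_add]
  ring

/-- The difference equation of the Bernoulli polynomials. -/
lemma scaledBernoulli_add_self_sub {f : ℕ} (hf : f ≠ 0) (n : ℕ) (x : K) :
    scaledBernoulli (n + 1) f (x + f) - scaledBernoulli (n + 1) f x = (n + 1) * x ^ n := by
  have h : (PowerSeries.mk fun n => scaledBernoulli n f (x + f) / (n.factorial : K)) -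
      (PowerSeries.mk fun n => scaledBernoulli n f x / (n.factorial : K)) =
      PowerSeries.X * PowerSeries.rescale x (PowerSeries.exp K) := by
    refine mul_right_cancel₀ (rescale_exp_sub_one_ne_zero (K := K) hf) ?_
    rw [sub_mul, mk_scaledBernoulli_mul hf, mk_scaledBernoulli_mul hf,
      ← PowerSeries.exp_mul_exp_eq_exp_add]
    ring
  have h1 := congrArg (PowerSeries.coeff (n + 1)) h
  rw [PowerSeries.coeff_succ_X_mul, map_sub, PowerSeries.coeff_mk, PowerSeries.coeff_mk,
    PowerSeries.coeff_rescale, PowerSeries.coeff_exp, Nat.factorial_succ] at h1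
  have h2 : (n.factorial : K) ≠ 0 := Nat.cast_ne_zero.2 n.factorial_ne_zero
  have h3 : (n : K) + 1 ≠ 0 := Nat.cast_add_one_ne_zero n
  simp only [map_div₀, map_one, map_natCast] at h1
  push_cast at h1
  field_simp at h1
  linear_combination h1

/-- The multiplication theorem of the Bernoulli polynomials. -/
lemma sum_scaledBernoulli_mul {f k : ℕ} (hf : f ≠ 0) (hk : k ≠ 0) (n : ℕ) (x : K) :
    ∑ i ∈ Finset.range k, scaledBernoulli n (f * k) (x + (i * f : ℕ)) = scaledBernoulli n f x := by
  have hfk : f * k ≠ 0 := mul_ne_zero hf hk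
  refine eq_of_mk_mul_eq hfk (u := fun n => ∑ i ∈ Finset.range k,
    scaledBernoulli n (f * k) (x + (i * f : ℕ))) (v := fun n => scaledBernoulli n f x) ?_ n
  refine mul_right_cancel₀ (rescale_exp_sub_one_ne_zero (K := K) hf) ?_
  rw [mul_right_comm _ _ (PowerSeries.rescale (f : K) (PowerSeries.exp K) - 1),
    mul_right_comm _ _ (PowerSeries.rescale (f : K) (PowerSeries.exp K) - 1),
    mk_scaledBernoulli_mul hf]
  have h : (PowerSeries.mk fun n => (∑ i ∈ Finset.range k,
      scaledBernoulli n (f * k) (x + (i * f : ℕ))) / (n.factorial : K)) =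
      ∑ i ∈ Finset.range k, PowerSeries.mk fun n =>
        scaledBernoulli n (f * k) (x + (i * f : ℕ)) / (n.factorial : K) := by
    ext n
    simp [Finset.sum_div]
  have he : ∀ i : ℕ, PowerSeries.rescale ((i * f : ℕ) : K) (PowerSeries.exp K) =
      PowerSeries.rescale (f : K) (PowerSeries.exp K) ^ i := by
    intro i
    induction i with
    | zero => ext m; cases m <;> simp [PowerSeries.coeff_one]
    | succ i ih =>
      rw [pow_succ, ← ih, PowerSeries.exp_mul_exp_eq_exp_add]
      congr 2
      push_cast; ring
  rw [h, mul_right_comm, Finset.sum_mul]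
  simp_rw [mk_scaledBernoulli_mul hfk, ← PowerSeries.exp_mul_exp_eq_exp_add, he]
  rw [mul_comm f k, he]
  simp_rw [← mul_assoc]
  rw [← Finset.mul_sum, mul_assoc, geom_sum_mul]

lemma scaledBernoulli_mul {q : ℕ} (hq : q ≠ 0) (n f : ℕ) (x : K) :
    scaledBernoulli n (q * f) (q * x) = (q : K) ^ ((n : ℤ) - 1) * scaledBernoulli n f x := by
  have hqK : (q : K) ≠ 0 := Nat.cast_ne_zero.2 hq
  rw [scaledBernoulli, scaledBernoulli, Nat.cast_mul, mul_zpow, mul_div_mul_left _ _ hqK, mul_assoc]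

/-- The Bernoulli number of a periodic function does not depend on the chosen period. -/
lemma periodicBernoulli_mul {f k : ℕ} (hf : f ≠ 0) (hk : k ≠ 0) (n : ℕ) {h : ℕ → K}
    (hh : ∀ a, h (a + f) = h a) : periodicBernoulli n (f * k) h = periodicBernoulli n f h := by
  have hper : ∀ a i : ℕ, h (a + i * f) = h a := by
    intro a i
    induction i with
    | zero => simp
    | succ i ih => rw [Nat.succ_mul, ← add_assoc, hh, ih]
  have hIcc : ∀ (m : ℕ) (g : ℕ → K), ∑ a ∈ Finset.Icc 1 m, g a = ∑ a ∈ Finset.range m, g (a + 1) := by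
    intro m g
    rw [Finset.range_eq_Ico, Finset.sum_Ico_add', zero_add]
    rfl
  have hdiv : ∀ (k : ℕ) (g : ℕ → K), ∑ a ∈ Finset.range (f * k), g a =
      ∑ i ∈ Finset.range k, ∑ a ∈ Finset.range f, g (a + i * f) := by
    intro k g
    induction k with
    | zero => simp
    | succ k ih =>
      rw [Nat.mul_succ, Finset.sum_range_add, ih, Finset.sum_range_succ]
      congr 1
      exact Finset.sum_congr rfl fun a _ => by rw [add_comm, mul_comm]
  rw [periodicBernoulli, periodicBernoulli, hIcc, hIcc, hdiv, Finset.sum_comm]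
  refine Finset.sum_congr rfl fun a _ => ?_
  rw [← sum_scaledBernoulli_mul hf hk, Finset.mul_sum]
  refine Finset.sum_congr rfl fun i _ => ?_
  rw [add_right_comm, hper]
  push_cast
  rfl

lemma periodicBernoulli_congr {f n : ℕ} {g h : ℕ → K} (H : ∀ a, g a = h a) :
    periodicBernoulli n f g = periodicBernoulli n f h := by
  rw [funext H]

/-- Restriction to the multiples of `q`: if `h` has period `f`, so has `a ↦ h (q a)`. -/
lemma periodicBernoulli_multiples {f q : ℕ} (hf : f ≠ 0) (hq : q ≠ 0) (hqf : q ∣ f) (n : ℕ)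
    {h : ℕ → K} (hh : ∀ a, h (a + f) = h a) :
    periodicBernoulli n f (fun a => if q ∣ a then h a else 0) =
      (q : K) ^ ((n : ℤ) - 1) * periodicBernoulli n f fun a => h (q * a) := by
  rw [← periodicBernoulli_mul hf hq n (h := fun a => if q ∣ a then h a else 0)
    (fun a => by simp only [Nat.dvd_add_left hqf, hh])]
  rw [periodicBernoulli, periodicBernoulli, Finset.mul_sum]
  simp_rw [ite_mul, zero_mul]
  rw [← Finset.sum_filter]
  refine (Finset.sum_nbij (fun a => q * a) ?_ ?_ ?_ ?_).symm
  · intro a ha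
    simp only [Finset.mem_Icc, Finset.mem_filter] at ha ⊢
    exact ⟨⟨Nat.mul_pos (Nat.pos_of_ne_zero hq) ha.1, by nlinarith [ha.2]⟩, dvd_mul_right _ _⟩
  · intro a _ b _ hab
    exact Nat.eq_of_mul_eq_mul_left (Nat.pos_of_ne_zero hq) hab
  · intro b hb
    simp only [Finset.coe_filter, Finset.mem_Icc, Set.mem_ofPred_eq] at hb
    obtain ⟨⟨hb1, hb2⟩, a, rfl⟩ := hb
    refine ⟨a, ?_, rfl⟩
    simp only [Finset.coe_Icc, Set.mem_Icc]
    refine ⟨Nat.pos_of_ne_zero (by rintro rfl; simp at hb1), ?_⟩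
    rw [mul_comm f q] at hb2
    exact Nat.le_of_mul_le_mul_left hb2 (Nat.pos_of_ne_zero hq)
  · intro a _
    rw [mul_comm f q, Nat.cast_mul, scaledBernoulli_mul hq]
    ring

end PeriodicBernoulli

/-! ### Imprimitive characters and sums of powers -/

section Imprimitive

lemma changeLevel_natCast {K : Type*} [Field K] {f r : ℕ} (hr : r ≠ 0) (h : f ∣ r) (ψ : DirichletCharacter K f) (a : ℕ) :
    DirichletCharacter.changeLevel h ψ (a : ZMod r) =
      ψ (a : ZMod f) * ∏ q ∈ r.primeFactors, if q ∣ a then (0 : K) else 1 := by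
  by_cases ha : a.Coprime r
  · have h1 := DirichletCharacter.changeLevel_eq_cast_of_dvd' ψ h (a := (a : ℤ))
      (Nat.isCoprime_iff_coprime.2 ha)
    simp only [Int.cast_natCast] at h1
    rw [h1, Finset.prod_eq_one, mul_one]
    intro q hq
    rw [if_neg]
    intro hqa
    have hq' := Nat.mem_primeFactors.1 hq
    exact hq'.1.not_dvd_one (ha ▸ Nat.dvd_gcd hqa hq'.2.1)
  · obtain ⟨q, hq, hqa, hqr⟩ := Nat.Prime.not_coprime_iff_dvd.1 ha
    have h0 : ∏ q ∈ r.primeFactors, (if q ∣ a then (0 : K) else 1) = 0 :=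
      Finset.prod_eq_zero (Nat.mem_primeFactors.2 ⟨hq, hqr, hr⟩) (if_pos hqa)
    rw [h0, mul_zero]
    exact MulChar.map_nonunit _ fun hu => ha ((ZMod.isUnit_iff_coprime a r).1 hu)

open Classical in
/-- Every character modulo `r` comes from exactly one primitive character. -/
lemma sum_dirichletCharacter_eq_sum_primitive {K : Type*} [Field K] {M : Type*} [AddCommMonoid M] {r : ℕ} [NeZero r]
    (G : DirichletCharacter K r → M) (H : (f : ℕ) → DirichletCharacter K f → M)
    (hGH : ∀ (f : ℕ) (h : f ∣ r) (ψ : DirichletCharacter K f), ψ.IsPrimitive →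
      G (DirichletCharacter.changeLevel h ψ) = H f ψ) :
    ∑ χ, G χ = ∑ f ∈ r.divisors, ∑ ψ : DirichletCharacter K f with ψ.IsPrimitive, H f ψ := by
  have hr : r ≠ 0 := NeZero.ne r
  rw [← Finset.sum_fiberwise_of_maps_to (s := Finset.univ) (t := r.divisors)
    (g := fun χ : DirichletCharacter K r => χ.conductor)
    (fun χ _ => Nat.mem_divisors.2 ⟨χ.conductor_dvd_level, hr⟩)]
  refine Finset.sum_congr rfl fun f hf => ?_
  have hfr : f ∣ r := Nat.dvd_of_mem_divisors hf
  symm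
  refine Finset.sum_bij (fun ψ _ => DirichletCharacter.changeLevel hfr ψ) ?_ ?_ ?_ ?_
  · intro ψ hψ
    simp only [Finset.mem_filter, Finset.mem_univ, true_and] at hψ ⊢
    rw [DirichletCharacter.conductor_changeLevel]
    exact hψ
  · intro ψ₁ _ ψ₂ _ h
    exact DirichletCharacter.changeLevel_injective hfr h
  · intro χ hχ
    simp only [Finset.mem_filter, Finset.mem_univ, true_and] at hχ
    subst hχ
    exact ⟨χ.primitiveCharacter, by simpa using χ.primitiveCharacter_isPrimitive,
      χ.changeLevel_primitiveCharacter⟩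
  · intro ψ hψ
    exact (hGH f hfr ψ (Finset.mem_filter.1 hψ).2).symm

variable {K : Type*} [Field K] [CharZero K]

/-- Bernoulli numbers of an imprimitive character, by removing the multiples of one prime after
another. -/
lemma periodicBernoulli_prod {f r : ℕ} (hr : r ≠ 0) (h : f ∣ r) (ψ : DirichletCharacter K f)
    (n : ℕ) (Q : Finset ℕ) (hQ : ∀ q ∈ Q, q.Prime ∧ q ∣ r) :
    periodicBernoulli n r (fun a => ψ (a : ZMod f) * ∏ q ∈ Q, if q ∣ a then (0 : K) else 1) =
      (∏ q ∈ Q, (1 - ψ (q : ZMod f) * (q : K) ^ ((n : ℤ) - 1))) * genBernoulli n ψ := by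
  have hper : ∀ (Q : Finset ℕ), (∀ q ∈ Q, q.Prime ∧ q ∣ r) → ∀ a : ℕ,
      ψ ((a + r : ℕ) : ZMod f) * ∏ q ∈ Q, (if q ∣ a + r then (0 : K) else 1) =
        ψ (a : ZMod f) * ∏ q ∈ Q, if q ∣ a then (0 : K) else 1 := by
    intro Q hQ a
    congr 1
    · rw [Nat.cast_add, (ZMod.natCast_eq_zero_iff r f).2 h, add_zero]
    · exact Finset.prod_congr rfl fun q hq => by simp only [Nat.dvd_add_left (hQ q hq).2]
  induction Q using Finset.induction_on with
  | empty =>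
    obtain ⟨k, rfl⟩ := h
    have hf : f ≠ 0 := left_ne_zero_of_mul hr
    have hk : k ≠ 0 := right_ne_zero_of_mul hr
    simp only [Finset.prod_empty, mul_one, one_mul]
    rw [genBernoulli_eq_periodicBernoulli, periodicBernoulli_mul hf hk]
    intro a
    simp
  | insert q Q hq ih =>
    have hQ' : ∀ q ∈ Q, q.Prime ∧ q ∣ r := fun x hx => hQ x (Finset.mem_insert_of_mem hx)
    obtain ⟨hqp, hqr⟩ := hQ q (Finset.mem_insert_self _ _)
    have h1 : ∀ a : ℕ, ψ (a : ZMod f) * ∏ x ∈ insert q Q, (if x ∣ a then (0 : K) else 1) =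
        ψ (a : ZMod f) * (∏ x ∈ Q, if x ∣ a then (0 : K) else 1) -
          (if q ∣ a then ψ (a : ZMod f) * (∏ x ∈ Q, if x ∣ a then (0 : K) else 1) else 0) := by
      intro a
      rw [Finset.prod_insert hq]
      split_ifs <;> ring
    rw [periodicBernoulli_congr h1]
    have h2 : ∀ (g₁ g₂ : ℕ → K), periodicBernoulli n r (fun a => g₁ a - g₂ a) =
        periodicBernoulli n r g₁ - periodicBernoulli n r g₂ := by
      intro g₁ g₂
      simp only [periodicBernoulli, sub_mul, Finset.sum_sub_distrib]
    rw [h2, periodicBernoulli_multiples hr hqp.ne_zero hqr n (hper Q hQ')]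
    have h3 : ∀ a : ℕ, ψ ((q * a : ℕ) : ZMod f) * (∏ x ∈ Q, if x ∣ q * a then (0 : K) else 1) =
        ψ (q : ZMod f) * (ψ (a : ZMod f) * (∏ x ∈ Q, if x ∣ a then (0 : K) else 1)) := by
      intro a
      rw [Nat.cast_mul, map_mul, mul_assoc]
      congr 2
      refine Finset.prod_congr rfl fun x hx => ?_
      have hxq : x.Coprime q := (Nat.coprime_primes (hQ' x hx).1 hqp).2 (by rintro rfl; exact hq hx)
      simp only [hxq.dvd_mul_left]
    rw [periodicBernoulli_congr h3]
    have h4 : ∀ (c : K) (g : ℕ → K), periodicBernoulli n r (fun a => c * g a) =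
        c * periodicBernoulli n r g := by
      intro c g
      simp only [periodicBernoulli, Finset.mul_sum, mul_assoc]
    rw [h4, ih hQ', Finset.prod_insert hq]
    ring

lemma genBernoulli_changeLevel {f r : ℕ} (hr : r ≠ 0) (h : f ∣ r) (ψ : DirichletCharacter K f)
    (n : ℕ) : genBernoulli n (DirichletCharacter.changeLevel h ψ) =
      eulerD ψ r ((n : ℤ) - 1) * genBernoulli n ψ := by
  rw [genBernoulli_eq_periodicBernoulli, periodicBernoulli_congr (changeLevel_natCast hr h ψ),
    periodicBernoulli_prod hr h ψ n _ fun q hq =>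
      ⟨Nat.prime_of_mem_primeFactors hq, Nat.dvd_of_mem_primeFactors hq⟩, eulerD]
  congr 1
  symm
  refine Finset.prod_subset (Nat.primeFactors_mono (Nat.div_dvd_of_dvd h) hr) fun q hq hq' => ?_
  -- a prime factor of `r` that does not divide `r / f` divides `f`, and then `ψ q = 0`
  have hqp := Nat.prime_of_mem_primeFactors hq
  have hqf : q ∣ f := by
    have h1 : q ∣ f * (r / f) := by
      rw [Nat.mul_div_cancel' h]; exact Nat.dvd_of_mem_primeFactors hq
    refine (hqp.dvd_mul.1 h1).resolve_right fun h2 => hq' ?_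
    exact Nat.mem_primeFactors.2 ⟨hqp, h2, (Nat.div_pos (Nat.le_of_dvd (Nat.pos_of_ne_zero hr) h)
      (Nat.pos_of_ne_zero (ne_zero_of_dvd_ne_zero hr h))).ne'⟩
  rw [MulChar.map_nonunit ψ fun hu => ?_, zero_mul, sub_zero]
  have := (ZMod.isUnit_iff_coprime q f).1 hu
  exact hqp.not_dvd_one (this ▸ Nat.dvd_gcd dvd_rfl hqf)

/-- The sum of the `s`-th powers up to `N / r` in terms of Bernoulli numbers of the characters
modulo `r`: the orthogonality relations single out the residue class of `-N`, in which `a + N` is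
a multiple of `r`. -/
lemma sum_pow_div_eq {r N s : ℕ} [NeZero r] [HasEnoughRootsOfUnity K (Monoid.exponent (ZMod r)ˣ)]
    (hN : N.Coprime r) :
    ((s + 1 : ℕ) : K) * ∑ k ∈ Finset.Icc 1 (N / r), (k : K) ^ s =
      -genBernoulli (s + 1) (1 : DirichletCharacter K 1) + ((r : K) ^ s * (r.totient : K))⁻¹ *
        ∑ χ : DirichletCharacter K r, χ⁻¹ (-(N : ZMod r)) *
          ∑ n ∈ Finset.range (s + 2), ((s + 1).choose n : K) * (N : K) ^ n *
            genBernoulli (s + 1 - n) χ := by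
  have hr : r ≠ 0 := NeZero.ne r
  have hrK : (r : K) ≠ 0 := Nat.cast_ne_zero.2 hr
  have hφ : (r.totient : K) ≠ 0 := Nat.cast_ne_zero.2 (Nat.totient_pos.2 (Nat.pos_of_ne_zero hr)).ne'
  -- telescoping with the difference equation
  have htel : ∀ L : ℕ, ((s + 1 : ℕ) : K) * ∑ k ∈ Finset.Icc 1 L, (k : K) ^ s =
      scaledBernoulli (s + 1) 1 ((L + 1 : ℕ) : K) - scaledBernoulli (s + 1) 1 1 := by
    intro L
    induction L with
    | zero => simp
    | succ L ih =>
      have := scaledBernoulli_add_self_sub (K := K) one_ne_zero s ((L + 1 : ℕ) : K)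
      rw [Finset.sum_Icc_succ_top (by omega), mul_add, ih]
      push_cast at this ⊢
      linear_combination -this
  have hgen1 : genBernoulli (s + 1) (1 : DirichletCharacter K 1) = scaledBernoulli (s + 1) 1 1 := by
    rw [genBernoulli_eq_periodicBernoulli, periodicBernoulli]
    simp [MulChar.one_apply (isUnit_of_subsingleton _)]
  -- the inner sums are Bernoulli polynomials of `χ` at `N`
  have hinner : ∀ χ : DirichletCharacter K r,
      ∑ n ∈ Finset.range (s + 2), ((s + 1).choose n : K) * (N : K) ^ n *
        genBernoulli (s + 1 - n) χ =
      ∑ a ∈ Finset.Icc 1 r, χ (a : ZMod r) * scaledBernoulli (s + 1) r ((a : K) + N) := by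
    intro χ
    simp_rw [genBernoulli_eq_periodicBernoulli, periodicBernoulli, scaledBernoulli_add hr,
      Finset.mul_sum]
    rw [Finset.sum_comm]
    exact Finset.sum_congr rfl fun a _ => Finset.sum_congr rfl fun n _ => by ring
  have hu : IsUnit (-(N : ZMod r)) := ((ZMod.isUnit_iff_coprime N r).2 hN).neg
  have hinv : Ring.inverse (-(N : ZMod r)) = (-(N : ZMod r))⁻¹ := by
    obtain ⟨u, hu'⟩ := hu
    rw [← hu', Ring.inverse_unit, ZMod.inv_coe_unit]
  set a₀ : ℕ := r - N % r with ha₀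
  have hmod : N % r < r := Nat.mod_lt _ (Nat.pos_of_ne_zero hr)
  have hsum : a₀ + N = r * (N / r + 1) := by
    have := Nat.div_add_mod N r
    rw [mul_add, mul_one]
    omega
  have hmem : a₀ ∈ Finset.Icc 1 r := Finset.mem_Icc.2 ⟨by omega, by omega⟩
  have ha₀' : -(N : ZMod r) = (a₀ : ZMod r) := by
    have : ((a₀ + N : ℕ) : ZMod r) = 0 := by
      rw [hsum]; simp
    rw [Nat.cast_add] at this
    exact (eq_neg_of_add_eq_zero_left this).symm
  have hmain : ∑ χ : DirichletCharacter K r, χ⁻¹ (-(N : ZMod r)) *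
        ∑ n ∈ Finset.range (s + 2), ((s + 1).choose n : K) * (N : K) ^ n *
          genBernoulli (s + 1 - n) χ =
      (r.totient : K) * scaledBernoulli (s + 1) r (((a₀ : ℕ) : K) + N) := by
    simp_rw [hinner, Finset.mul_sum]
    rw [Finset.sum_comm]
    rw [Finset.sum_eq_single_of_mem a₀ hmem]
    · simp_rw [← mul_assoc]
      rw [← Finset.sum_mul]
      congr 1
      simp_rw [MulChar.inv_apply, hinv]
      rw [DirichletCharacter.sum_char_inv_mul_char_eq K hu, if_pos ha₀']
    · intro a ha hne
      simp_rw [← mul_assoc]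
      rw [← Finset.sum_mul]
      simp_rw [MulChar.inv_apply, hinv]
      rw [DirichletCharacter.sum_char_inv_mul_char_eq K hu, if_neg, zero_mul]
      rw [ha₀']
      intro heq
      rw [ZMod.natCast_eq_natCast_iff] at heq
      have ha' := Finset.mem_Icc.1 ha
      have h0 := Finset.mem_Icc.1 hmem
      have hd : (r : ℤ) ∣ (a : ℤ) - a₀ := Nat.modEq_iff_dvd.1 heq
      have := Int.eq_zero_of_abs_lt_dvd hd (by rw [abs_lt]; constructor <;> omega)
      omega
  rw [htel, hmain, hgen1]
  have hfin : scaledBernoulli (s + 1) r ((a₀ : K) + N) =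
      (r : K) ^ s * scaledBernoulli (s + 1) 1 ((N / r + 1 : ℕ) : K) := by
    have h1 : (a₀ : K) + N = r * ((N / r + 1 : ℕ) : K) := by exact_mod_cast hsum
    have h2 := scaledBernoulli_mul hr (s + 1) 1 ((N / r + 1 : ℕ) : K)
    rw [mul_one, ← h1] at h2
    rw [h2]
    congr 1
    rw [← zpow_natCast]
    congr 1
    push_cast
    ring
  rw [hfin]
  field_simp
  ring

end Imprimitive

/-! ### Bernoulli numbers as moments with integral weights -/

section Moments

variable {p : ℕ} [Fact p.Prime]

open Polynomial

lemma exists_polynomial_eval_eq_scaledBernoulli {K : Type*} [Field K] [CharZero K] (n f : ℕ) :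
    ∃ P : K[X], P.natDegree ≤ n ∧ ∀ x : K, P.eval x = scaledBernoulli n f x := by
  refine ⟨C ((f : K) ^ ((n : ℤ) - 1)) *
    ((Polynomial.bernoulli n).map (algebraMap ℚ K)).comp (C (f : K)⁻¹ * X), ?_, fun x => ?_⟩
  · refine natDegree_C_mul_le _ _ |>.trans (natDegree_comp_le.trans ?_)
    have h1 : ((Polynomial.bernoulli n).map (algebraMap ℚ K)).natDegree ≤ n := by
      refine natDegree_map_le.trans ?_
      rw [Polynomial.bernoulli]
      exact natDegree_sum_le_of_forall_le _ _ fun i _ =>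
        (natDegree_monomial_le _).trans (Nat.sub_le _ _)
    have h2 : (C (f : K)⁻¹ * X : K[X]).natDegree ≤ 1 := (natDegree_C_mul_le _ _).trans natDegree_X_le
    exact (Nat.mul_le_mul h1 h2).trans (by simp)
  · rw [eval_mul, eval_C, eval_comp, eval_map_algebraMap, scaledBernoulli]
    simp [div_eq_inv_mul]

/-- If `h` is integral with mean value zero over a period prime to `p`, its Bernoulli numbers
`B_{t+1} / (t+1)` are moments `∑ w_x x ^ t` with integral weights `w_x`. The weights are the
coefficients of an approximation, at `X = 1`, of the quotient of `∑ h(a) X ^ a` by `X ^ f - 1`: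
the simple zero of the denominator cancels and the remaining factor is a unit at `X = 1`. -/
lemma exists_moments {f : ℕ} (hf : ¬ p ∣ f) {h : ℕ → ℂ_[p]} (hh : ∀ a, h a ∈ 𝓞_ℂ_[p])
    (hsum : ∑ a ∈ Finset.Icc 1 f, h a = 0) (T : ℕ) :
    ∃ (s : Finset ℕ) (w : ℕ → ℂ_[p]), (∀ x, w x ∈ 𝓞_ℂ_[p]) ∧
      ∀ t ≤ T, periodicBernoulli (t + 1) f h = ((t + 1 : ℕ) : ℂ_[p]) *
        ∑ x ∈ s, w x * (x : ℂ_[p]) ^ t := by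
  have hf0 : f ≠ 0 := by rintro rfl; exact hf (dvd_zero p)
  have hfp : (f : ℂ_[p]) ≠ 0 := Nat.cast_ne_zero.2 hf0
  set A : 𝓞_ℂ_[p][X] := ∑ a ∈ Finset.Icc 1 f, monomial a ⟨h a, hh a⟩ with hA
  set V : 𝓞_ℂ_[p][X] := ∑ i ∈ Finset.range f, X ^ i with hV
  have hXV : (X - 1) * V = X ^ f - 1 := mul_geom_sum _ _
  obtain ⟨A₁, hA₁⟩ : X - 1 ∣ A := by
    rw [← C_1, dvd_iff_isRoot, IsRoot, hA, eval_finsetSum]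
    simp only [eval_monomial, one_pow, mul_one]
    ext
    push_cast
    simpa using hsum
  obtain ⟨V₁, hV₁⟩ : X - 1 ∣ V - C (f : 𝓞_ℂ_[p]) := by
    rw [← C_1, dvd_iff_isRoot, IsRoot, hV]
    simp [eval_finsetSum]
  set f' : 𝓞_ℂ_[p] := ⟨(f : ℂ_[p])⁻¹, inv_natCast_mem_int hf⟩ with hf'
  have hff' : f' * f = 1 := by
    ext
    push_cast
    simp [hf', hfp]
  have hcop : IsCoprime (X - 1) V := by
    refine ⟨-C f' * V₁, C f', ?_⟩
    have h1 : (C f' : 𝓞_ℂ_[p][X]) * C (f : 𝓞_ℂ_[p]) = 1 := by rw [← C_mul, hff', C_1]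
    linear_combination h1 + C f' * hV₁
  obtain ⟨a, b, hab⟩ := hcop.pow_left (m := T + 1)
  set W : 𝓞_ℂ_[p][X] := b * A₁ with hW
  have hkey : A - (X ^ f - 1) * W = (X - 1) ^ (T + 2) * (a * A₁) := by
    rw [hA₁, ← hXV, hW]
    linear_combination (-(X - 1) * A₁) * hab
  let φ : 𝓞_ℂ_[p] →+* ℂ_[p] := 𝓞_ℂ_[p].subtype
  have hkey' : A.map φ - (X ^ f - 1) * W.map φ = (X - 1) ^ (T + 2) * (a * A₁).map φ := by
    have := congrArg (Polynomial.map φ) hkey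
    simpa using this
  refine ⟨(W.map φ).support, fun x => (W.map φ).coeff x, fun x => ?_, fun t ht => ?_⟩
  · simp only [coeff_map]; exact (W.coeff x).2
  · let L : ℂ_[p][X] →ₗ[ℂ_[p]] ℂ_[p] :=
      Polynomial.lsum fun a => LinearMap.mulRight ℂ_[p] (scaledBernoulli (t + 1) f (a : ℂ_[p]))
    have hLm : ∀ (a : ℕ) (c : ℂ_[p]), L (monomial a c) =
        c * scaledBernoulli (t + 1) f (a : ℂ_[p]) := by
      intro a c
      simp [L, lsum_apply]
    have hLA : L (A.map φ) = periodicBernoulli (t + 1) f h := by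
      rw [hA, Polynomial.map_sum, map_sum, periodicBernoulli]
      refine Finset.sum_congr rfl fun a _ => ?_
      rw [Polynomial.map_monomial, hLm]
      rfl
    have hLW : ∀ w : ℂ_[p][X], L ((X ^ f - 1) * w) =
        ((t + 1 : ℕ) : ℂ_[p]) * ∑ x ∈ w.support, w.coeff x * (x : ℂ_[p]) ^ t := by
      intro w
      conv_lhs => rw [w.as_sum_support, Finset.mul_sum, map_sum]
      rw [Finset.mul_sum]
      refine Finset.sum_congr rfl fun x _ => ?_
      rw [sub_mul, one_mul, X_pow_mul_monomial, map_sub, hLm, hLm]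
      have := scaledBernoulli_add_self_sub (K := ℂ_[p]) hf0 t x
      push_cast at this ⊢
      linear_combination w.coeff x * this
    have hLZ : L ((X - 1) ^ (T + 2) * (a * A₁).map φ) = 0 := by
      obtain ⟨P, hP, hPe⟩ := exists_polynomial_eval_eq_scaledBernoulli (K := ℂ_[p]) (t + 1) f
      set Z := (X - 1) ^ (T + 2) * (a * A₁).map φ with hZ
      obtain ⟨S, hS, hSc⟩ := exists_coeff_eq_eval_mul_coeff (A := Z) (Q := P) (j := T + 2)
        (Dvd.intro _ rfl) hP
      have hS1 : S.eval 1 = 0 := by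
        have h1 : (X - 1 : ℂ_[p][X]) ∣ S := (dvd_pow_self _ (by omega)).trans hS
        rw [← C_1, dvd_iff_isRoot] at h1
        exact h1
      have hsupp : ∀ x ∉ Z.support, S.coeff x = 0 := by
        intro x hx
        rw [hSc, notMem_support_iff.1 hx, mul_zero]
      rw [eval_eq_sum, Polynomial.sum_def] at hS1
      simp only [one_pow, mul_one] at hS1
      rw [Z.as_sum_support, map_sum]
      simp_rw [hLm, ← hPe, mul_comm (Z.coeff _), ← hSc]
      rw [← hS1]
      symm
      refine Finset.sum_subset (fun x hx => ?_) (fun x _ hx => notMem_support_iff.1 hx)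
      by_contra hx'
      exact mem_support_iff.1 hx (hsupp x hx')
    have := congrArg L hkey'
    rw [map_sub, hLA, hLW, hLZ] at this
    exact sub_eq_zero.1 this

lemma sum_Icc_dirichletCharacter {K : Type*} [Field K] {f : ℕ} [NeZero f]
    (χ : DirichletCharacter K f) : ∑ a ∈ Finset.Icc 1 f, χ (a : ZMod f) = ∑ a : ZMod f, χ a := by
  have hf : 0 < f := Nat.pos_of_ne_zero (NeZero.ne f)
  refine Finset.sum_bij (fun a _ => (a : ZMod f)) (fun _ _ => Finset.mem_univ _) ?_ ?_
    fun _ _ => rfl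
  · intro a ha b hb hab
    rw [ZMod.natCast_eq_natCast_iff] at hab
    have ha' := Finset.mem_Icc.1 ha
    have hb' := Finset.mem_Icc.1 hb
    have hd : (f : ℤ) ∣ (b : ℤ) - a := Nat.modEq_iff_dvd.1 hab
    have := Int.eq_zero_of_abs_lt_dvd hd (by rw [abs_lt]; constructor <;> omega)
    omega
  · intro z _
    by_cases hz : z = 0
    · exact ⟨f, Finset.mem_Icc.2 ⟨hf, le_rfl⟩, by simp [hz]⟩
    · refine ⟨z.val, Finset.mem_Icc.2 ⟨Nat.pos_of_ne_zero ?_, z.val_lt.le⟩, by simp⟩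
      rwa [Ne, ZMod.val_eq_zero]

lemma exists_moments_of_ne_one {f : ℕ} (hf : ¬ p ∣ f) {χ : DirichletCharacter ℂ_[p] f}
    (hχ : χ ≠ 1) (T : ℕ) :
    ∃ (s : Finset ℕ) (w : ℕ → ℂ_[p]), (∀ x, w x ∈ 𝓞_ℂ_[p]) ∧
      ∀ t ≤ T, genBernoulli (t + 1) χ = ((t + 1 : ℕ) : ℂ_[p]) *
        ∑ x ∈ s, w x * (x : ℂ_[p]) ^ t := by
  have : NeZero f := ⟨by rintro rfl; exact hf (dvd_zero p)⟩
  simp_rw [genBernoulli_eq_periodicBernoulli]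
  refine exists_moments hf (fun a => dirichletCharacter_mem_int χ a) ?_ T
  rw [sum_Icc_dirichletCharacter, MulChar.sum_eq_zero_of_ne_one hχ]

/-- For the trivial character, the mean value zero is reached by the factor `1 - c ^ (t + 1)`. -/
lemma exists_moments_one {c : ℕ} (hc : ¬ p ∣ c) (T : ℕ) :
    ∃ (s : Finset ℕ) (w : ℕ → ℂ_[p]), (∀ x, w x ∈ 𝓞_ℂ_[p]) ∧
      ∀ t ≤ T, (1 - (c : ℂ_[p]) ^ (t + 1)) *
          genBernoulli (t + 1) (1 : DirichletCharacter ℂ_[p] 1) =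
        ((t + 1 : ℕ) : ℂ_[p]) * ∑ x ∈ s, w x * (x : ℂ_[p]) ^ t := by
  have hc0 : c ≠ 0 := by rintro rfl; exact hc (dvd_zero p)
  obtain ⟨s, w, hw, h⟩ := exists_moments hc
    (h := fun a => 1 - c * if c ∣ a then 1 else 0)
    (fun a => by
      refine sub_mem (one_mem _) (mul_mem (natCast_mem _ _) ?_)
      split_ifs
      exacts [one_mem _, zero_mem _])
    (by
      have : (Finset.Icc 1 c).filter (c ∣ ·) = {c} := by
        ext a
        simp only [Finset.mem_filter, Finset.mem_Icc, Finset.mem_singleton]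
        constructor
        · rintro ⟨⟨h1, h2⟩, h3⟩
          exact le_antisymm h2 (Nat.le_of_dvd h1 h3)
        · rintro rfl
          exact ⟨⟨Nat.pos_of_ne_zero hc0, le_rfl⟩, dvd_rfl⟩
      rw [Finset.sum_sub_distrib, ← Finset.mul_sum, ← Finset.sum_filter, this]
      simp) T
  refine ⟨s, w, hw, fun t ht => ?_⟩
  rw [← h t ht]
  have h1 : periodicBernoulli (t + 1) c (fun _ => (1 : ℂ_[p])) =
      genBernoulli (t + 1) (1 : DirichletCharacter ℂ_[p] 1) := by
    have := periodicBernoulli_mul one_ne_zero hc0 (t + 1) (h := fun _ => (1 : ℂ_[p])) fun _ => rfl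
    rw [one_mul] at this
    rw [this, genBernoulli_eq_periodicBernoulli]
    exact periodicBernoulli_congr fun a => by rw [MulChar.one_apply (isUnit_of_subsingleton _)]
  have h2 := periodicBernoulli_multiples hc0 hc0 dvd_rfl (t + 1) (h := fun _ => (1 : ℂ_[p]))
    fun _ => rfl
  have h3 : periodicBernoulli (t + 1) c
        (fun a => 1 - (c : ℂ_[p]) * if c ∣ a then (1 : ℂ_[p]) else 0) =
      periodicBernoulli (t + 1) c (fun _ => (1 : ℂ_[p])) -
        c * periodicBernoulli (t + 1) c fun a => if c ∣ a then (1 : ℂ_[p]) else 0 := by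
    simp only [periodicBernoulli, Finset.mul_sum, ← Finset.sum_sub_distrib]
    exact Finset.sum_congr rfl fun a _ => by ring
  rw [h3, h2, h1]
  have h4 : (c : ℂ_[p]) ^ (((t + 1 : ℕ) : ℤ) - 1) = (c : ℂ_[p]) ^ t := by
    rw [← zpow_natCast]; congr 1; push_cast; ring
  rw [h4]
  ring

/-- Moments with integral weights, along exponents in a residue class modulo `p - 1`. -/
lemma exists_expCongr_moments (s : Finset ℕ) {w : ℕ → ℂ_[p]} (hw : ∀ x, w x ∈ 𝓞_ℂ_[p])
    {J m : ℕ} (hJ : J + m ≤ p - 1) (I : ℕ) :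
    ∃ F : ℕ → ℂ_[p], ExpCongr p J I F ∧
      ∀ i, 1 ≤ i → F i = ∑ x ∈ s, w x * (x : ℂ_[p]) ^ (i * (p - 1) - m) := by
  have hile : ∀ i, 1 ≤ i → p - 1 ≤ i * (p - 1) := fun i hi => Nat.le_mul_of_pos_left _ hi
  refine ⟨fun i => ∑ x ∈ s, if p ∣ x then
      (if i = 0 then 0 else w x * (x : ℂ_[p]) ^ (i * (p - 1) - m))
    else w x * ((x : ℂ_[p])⁻¹ ^ m) * ((x : ℂ_[p]) ^ (p - 1)) ^ i, ?_, ?_⟩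
  · refine ExpCongr.sum s fun x _ => ?_
    by_cases hx : p ∣ x
    · simp only [if_pos hx]
      refine ExpCongr.of_mem fun i _ => ?_
      split_ifs with hi
      · exact zero_mem _
      · have hx1 : (x : ℂ_[p]) ∈ pPow p 1 := by
          have := intCast_mem_pPow (p := p) (n := (x : ℤ)) (k := 1)
            (by rw [pow_one]; exact_mod_cast hx)
          simpa using this
        have := hile i (by omega)
        refine mul_mem_pPow (hw x) (pPow_le ?_ (pow_mem_pPow_of_mem hx1 _))
        omega
    · simp only [if_neg hx]
      exact ExpCongr.exp (mul_mem (hw x) (pow_mem (inv_natCast_mem_int hx) _))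
        (natCast_pow_sub_one_mem hx)
  · intro i hi
    refine Finset.sum_congr rfl fun x _ => ?_
    split_ifs with hx hi0
    · omega
    · rfl
    · have hx0 : (x : ℂ_[p]) ≠ 0 := Nat.cast_ne_zero.2 (by rintro rfl; exact hx (dvd_zero p))
      have := hile i hi
      rw [← pow_mul, mul_comm (p - 1) i, mul_assoc]
      congr 1
      rw [inv_pow, inv_mul_eq_iff_eq_mul₀ (pow_ne_zero _ hx0), ← pow_add]
      congr 1
      omega

/-- Kummer's congruences for a nontrivial character of conductor prime to `p`. -/
lemma exists_expCongr_genBernoulli {f : ℕ} (hf : ¬ p ∣ f) {χ : DirichletCharacter ℂ_[p] f}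
    (hχ : χ ≠ 1) {J m : ℕ} (hJ : J + m ≤ p - 1) (I : ℕ) :
    ∃ F : ℕ → ℂ_[p], ExpCongr p J I F ∧ ∀ i, 1 ≤ i → i ≤ I →
      F i = genBernoulli (i * (p - 1) + 1 - m) χ / ((i * (p - 1) + 1 - m : ℕ) : ℂ_[p]) := by
  obtain ⟨s, w, hw, h⟩ := exists_moments_of_ne_one hf hχ (I * (p - 1))
  obtain ⟨F, hF, hFi⟩ := exists_expCongr_moments s hw hJ I
  refine ⟨F, hF, fun i hi hiI => ?_⟩
  have h1 : p - 1 ≤ i * (p - 1) := Nat.le_mul_of_pos_left _ hi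
  have h2 : i * (p - 1) + 1 - m = i * (p - 1) - m + 1 := by omega
  have h3 : i * (p - 1) ≤ I * (p - 1) := Nat.mul_le_mul_right _ hiI
  rw [hFi i hi, h2, h _ (by omega), mul_div_cancel_left₀]
  exact Nat.cast_ne_zero.2 (Nat.succ_ne_zero _)

lemma exists_not_dvd_pow_sub_one (p : ℕ) [Fact p.Prime] :
    ∃ g : ℕ, ¬ p ∣ g ∧ ∀ t : ℕ, ¬ (p - 1) ∣ t → ∀ k, ¬ (p : ℤ) ∣ 1 - (((g ^ p ^ k : ℕ) : ℤ)) ^ t := by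
  obtain ⟨u, hu⟩ := IsCyclic.exists_generator (α := (ZMod p)ˣ)
  have hord : orderOf u = p - 1 := by
    rw [orderOf_eq_card_of_forall_mem_zpowers hu, Nat.card_eq_fintype_card, ZMod.card_units]
  have hval : (((u : ZMod p).val : ℕ) : ZMod p) = u := ZMod.natCast_zmod_val _
  refine ⟨(u : ZMod p).val, fun h => ?_, fun t ht k h => ht ?_⟩
  · rw [← ZMod.natCast_eq_zero_iff, hval] at h
    exact u.ne_zero h
  · rw [← ZMod.intCast_zmod_eq_zero_iff_dvd] at h
    push_cast at h
    rw [hval, ZMod.pow_card_pow, sub_eq_zero] at h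
    rw [← hord]
    exact orderOf_dvd_of_pow_eq_one (Units.ext (by rw [Units.val_pow_eq_pow_val, ← h, Units.val_one]))

/-- Kummer's congruences for the trivial character, away from the indices divisible by `p - 1`. -/
lemma exists_expCongr_genBernoulli_one {J m : ℕ} (hm : 2 ≤ m) (hJ : J + m ≤ p - 1) (I : ℕ) :
    ∃ F : ℕ → ℂ_[p], ExpCongr p J I F ∧ ∀ i, 1 ≤ i → i ≤ I →
      F i = genBernoulli (i * (p - 1) + 1 - m) (1 : DirichletCharacter ℂ_[p] 1) /
        ((i * (p - 1) + 1 - m : ℕ) : ℂ_[p]) := by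
  obtain ⟨g, hg, hgt⟩ := exists_not_dvd_pow_sub_one p
  -- `c` is a primitive root modulo `p` with `c ^ (p - 1) ≡ 1` modulo `p ^ (J + 1)`
  set c : ℕ := g ^ p ^ J with hcdef
  have hc : ¬ p ∣ c := fun h => hg ((Fact.out : p.Prime).dvd_of_dvd_pow h)
  have hc1 : (c : ℂ_[p]) ^ (p - 1) - 1 ∈ pPow p (J + 1) := by
    have := pow_prime_pow_sub_one_mem (natCast_pow_sub_one_mem hg) J
    rw [← pow_mul, mul_comm, pow_mul] at this
    simpa [hcdef] using this
  obtain ⟨s, w, hw, h⟩ := exists_moments_one hc (I * (p - 1))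
  obtain ⟨F, hF, hFi⟩ := exists_expCongr_moments s hw hJ I
  set β : ℕ → ℂ_[p] := fun i => genBernoulli (i * (p - 1) + 1 - m)
    (1 : DirichletCharacter ℂ_[p] 1) / ((i * (p - 1) + 1 - m : ℕ) : ℂ_[p]) with hβ
  have hle : ∀ i, 1 ≤ i → p - 1 ≤ i * (p - 1) := fun i hi => Nat.le_mul_of_pos_left _ hi
  have hnd : ∀ i, 1 ≤ i → ¬ (p - 1) ∣ i * (p - 1) + 1 - m := by
    intro i hi hd
    have h1 := hle i hi
    have h2 : (p - 1) ∣ m - 1 := by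
      have h3 : m - 1 = i * (p - 1) - (i * (p - 1) + 1 - m) := by omega
      rw [h3]
      exact Nat.dvd_sub (dvd_mul_left _ _) hd
    have := Nat.le_of_dvd (by omega) h2
    omega
  have hint : ∀ i, 1 ≤ i → (1 - (c : ℂ_[p]) ^ (i * (p - 1) + 1 - m))⁻¹ ∈ 𝓞_ℂ_[p] ∧
      1 - (c : ℂ_[p]) ^ (i * (p - 1) + 1 - m) ≠ 0 := by
    intro i hi
    have h1 := hgt _ (hnd i hi) J
    have h2 : ((1 - (((g ^ p ^ J : ℕ) : ℤ)) ^ (i * (p - 1) + 1 - m) : ℤ) : ℂ_[p]) =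
        1 - (c : ℂ_[p]) ^ (i * (p - 1) + 1 - m) := by
      rw [hcdef]; push_cast; rfl
    rw [← h2]
    exact ⟨inv_intCast_mem_int h1, Int.cast_ne_zero.2 fun h0 => h1 (h0 ▸ dvd_zero _)⟩
  have hmul : ∀ i, 1 ≤ i → i ≤ I →
      (1 - (c : ℂ_[p]) ^ (i * (p - 1) + 1 - m)) * β i = F i := by
    intro i hi hiI
    have h1 := hle i hi
    have h2 : i * (p - 1) + 1 - m = i * (p - 1) - m + 1 := by omega
    have h3 : i * (p - 1) ≤ I * (p - 1) := Nat.mul_le_mul_right _ hiI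
    simp only [hβ]
    rw [hFi i hi, h2, ← mul_div_assoc, h _ (by omega), mul_div_cancel_left₀]
    exact Nat.cast_ne_zero.2 (Nat.succ_ne_zero _)
  have hβint : ∀ i, 1 ≤ i → i ≤ I → β i ∈ 𝓞_ℂ_[p] := by
    intro i hi hiI
    obtain ⟨h1, h2⟩ := hint i hi
    have := mul_mem h1 (hF.mem_int hiI)
    rwa [← hmul i hi hiI, inv_mul_cancel_left₀ h2] at this
  obtain ⟨hu, hu0⟩ := hint 1 le_rfl
  set u : ℂ_[p] := 1 - (c : ℂ_[p]) ^ (1 * (p - 1) + 1 - m) with hudef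
  refine ⟨fun i => if i = 0 then u⁻¹ * F 0 else β i, ?_, fun i hi _ => if_neg (by omega)⟩
  refine (hF.const_mul hu).congr fun i hiI => ?_
  split_ifs with hi0
  · simp [hi0]
  · have hi : 1 ≤ i := by omega
    have h1 : β i - u⁻¹ * F i = u⁻¹ * (c : ℂ_[p]) ^ (1 * (p - 1) + 1 - m) * β i *
        (((c : ℂ_[p]) ^ (p - 1)) ^ (i - 1) - 1) := by
      have h2 : i * (p - 1) + 1 - m = (1 * (p - 1) + 1 - m) + (p - 1) * (i - 1) := by
        obtain ⟨k, rfl⟩ : ∃ k, i = k + 1 := ⟨i - 1, by omega⟩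
        have : (k + 1) * (p - 1) = k * (p - 1) + (p - 1) := by ring
        rw [this, Nat.add_sub_cancel, mul_comm (p - 1) k]
        omega
      rw [← hmul i hi hiI, h2, pow_add, pow_mul]
      field_simp
      rw [hudef]
      ring
    rw [h1]
    refine mul_mem_pPow (mul_mem (mul_mem hu (pow_mem (natCast_mem _ _) _)) (hβint i hi hiI)) ?_
    exact pow_sub_one_mem (pPow_le (Nat.le_succ J) hc1) _

end Moments

/-! ### Denominators of Bernoulli numbers -/

section VonStaudt

variable {p : ℕ} [Fact p.Prime]

lemma pow_div_mem_int {m n : ℕ} (hm : m ≠ 0) (h : ∀ v, p ^ v ∣ m → v ≤ n) :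
    (p : ℂ_[p]) ^ n / (m : ℂ_[p]) ∈ 𝓞_ℂ_[p] := by
  obtain ⟨v, m', hm', rfl⟩ := Nat.exists_eq_pow_mul_and_not_dvd hm p (Fact.out : p.Prime).ne_one
  have hv : v ≤ n := h v (dvd_mul_right _ _)
  have hp := natCast_prime_ne_zero (p := p)
  have hm0 : (m' : ℂ_[p]) ≠ 0 := Nat.cast_ne_zero.2 (by rintro rfl; exact hm' (dvd_zero p))
  have h1 : (p : ℂ_[p]) ^ n / ((p ^ v * m' : ℕ) : ℂ_[p]) =
      (p : ℂ_[p]) ^ (n - v) * (m' : ℂ_[p])⁻¹ := by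
    rw [← Nat.sub_add_cancel hv, pow_add, Nat.add_sub_cancel]
    push_cast
    field_simp
  rw [h1]
  exact mul_mem (pow_mem (natCast_mem _ _) _) (inv_natCast_mem_int hm')

lemma le_of_prime_pow_dvd_succ {n v : ℕ} (h : p ^ v ∣ n + 1) : v ≤ n := by
  have h1 : p ^ v ≤ n + 1 := Nat.le_of_dvd (Nat.succ_pos _) h
  have h2 : v < p ^ v := Nat.lt_pow_self (Fact.out : p.Prime).one_lt
  omega

lemma pow_div_mul_succ_mem_int {n : ℕ} (hn : n ≠ 0) :
    (p : ℂ_[p]) ^ n / ((n * (n + 1) : ℕ) : ℂ_[p]) ∈ 𝓞_ℂ_[p] := by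
  have hp : p.Prime := Fact.out
  refine pow_div_mem_int (mul_ne_zero hn (Nat.succ_ne_zero _)) fun v hv => ?_
  rcases Nat.eq_zero_or_pos v with rfl | hv0
  · omega
  have hcop : n.Coprime (n + 1) := by simp
  rcases (hcop.isPrimePow_dvd_mul (hp.isPrimePow.pow hv0.ne')).1 hv with h | h
  · have h1 : p ^ v ≤ n := Nat.le_of_dvd (Nat.pos_of_ne_zero hn) h
    have h2 : v < p ^ v := Nat.lt_pow_self hp.one_lt
    omega
  · exact le_of_prime_pow_dvd_succ h

/-- Faulhaber's formula for `∑ k < p, k ^ t`, solved for `p B_t`. -/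
lemma prime_mul_bernoulli_eq (t : ℕ) :
    (p : ℂ_[p]) * (bernoulli t : ℚ) = ∑ k ∈ Finset.range p, (k : ℂ_[p]) ^ t -
      ∑ i ∈ Finset.range t, ((p : ℂ_[p]) * (bernoulli i : ℚ)) * (t.choose i : ℂ_[p]) *
        ((p : ℂ_[p]) ^ (t - i) / ((t - i + 1 : ℕ) : ℂ_[p])) := by
  have h := congrArg (fun x : ℚ => (x : ℂ_[p])) (sum_range_pow p t)
  simp only [Finset.sum_range_succ] at h
  push_cast at h
  have ht : (t : ℂ_[p]) + 1 ≠ 0 := Nat.cast_add_one_ne_zero t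
  have hlast : ((bernoulli t : ℚ) : ℂ_[p]) * ((t + 1).choose t : ℂ_[p]) *
      (p : ℂ_[p]) ^ (t + 1 - t) / ((t : ℂ_[p]) + 1) = (p : ℂ_[p]) * (bernoulli t : ℚ) := by
    rw [Nat.add_sub_cancel_left, Nat.choose_succ_self_right]
    push_cast
    field_simp
  rw [hlast] at h
  rw [h, eq_sub_iff_add_eq, add_comm]
  congr 1
  refine Finset.sum_congr rfl fun i hi => ?_
  have hi' : i < t := Finset.mem_range.1 hi
  have h1 : ((t - i + 1 : ℕ) : ℂ_[p]) ≠ 0 := Nat.cast_ne_zero.2 (Nat.succ_ne_zero _)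
  have h2 : ((t + 1).choose i : ℂ_[p]) * ((t - i + 1 : ℕ) : ℂ_[p]) =
      (t.choose i : ℂ_[p]) * ((t : ℂ_[p]) + 1) := by
    have := Nat.choose_mul_succ_eq t i
    rw [show t + 1 - i = t - i + 1 by omega] at this
    exact_mod_cast this.symm
  rw [show t + 1 - i = (t - i) + 1 by omega, pow_succ]
  rw [mul_div_assoc', div_eq_div_iff h1 ht]
  linear_combination (-(bernoulli i : ℂ_[p]) * (p : ℂ_[p]) ^ (t - i) * p) * h2

/-- The weak form of von Staudt's theorem. -/
lemma prime_mul_bernoulli_mem_int (t : ℕ) : (p : ℂ_[p]) * (bernoulli t : ℚ) ∈ 𝓞_ℂ_[p] := by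
  induction t using Nat.strong_induction_on with
  | _ t ih =>
    rw [prime_mul_bernoulli_eq]
    refine sub_mem (sum_mem fun k _ => pow_mem (natCast_mem _ _) _) (sum_mem fun i hi => ?_)
    refine mul_mem (mul_mem (ih i (Finset.mem_range.1 hi)) (natCast_mem _ _)) ?_
    exact pow_div_mem_int (Nat.succ_ne_zero _) fun v hv => le_of_prime_pow_dvd_succ hv

/-- `p B_t ≡ p - 1` modulo `p ^ M` for `t = p ^ M (p - 1)`. -/
lemma prime_mul_bernoulli_sub_mem (M : ℕ) :
    (p : ℂ_[p]) * (bernoulli (p ^ M * (p - 1)) : ℚ) - ((p : ℂ_[p]) - 1) ∈ pPow p M := by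
  have hp : p.Prime := Fact.out
  set t := p ^ M * (p - 1) with ht
  have ht0 : t ≠ 0 := mul_ne_zero (pow_ne_zero _ hp.ne_zero) (by have := hp.two_le; omega)
  have h1 : ∑ k ∈ Finset.range p, (k : ℂ_[p]) ^ t - ((p : ℂ_[p]) - 1) ∈ pPow p M := by
    have h2 : ∑ k ∈ Finset.range p, (k : ℂ_[p]) ^ t - ((p : ℂ_[p]) - 1) =
        ∑ k ∈ Finset.range (p - 1), (((k + 1 : ℕ) : ℂ_[p]) ^ t - 1) := by
      have hr : Finset.range p = Finset.range (p - 1 + 1) := by rw [Nat.sub_add_cancel hp.one_le]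
      have hc : ((p - 1 : ℕ) : ℂ_[p]) = p - 1 := by rw [Nat.cast_sub hp.one_le, Nat.cast_one]
      rw [hr, Finset.sum_range_succ', Finset.sum_sub_distrib]
      simp [ht0, hc]
    rw [h2]
    refine sum_mem fun k hk => ?_
    have hk' := Finset.mem_range.1 hk
    have hnd : ¬ p ∣ k + 1 := Nat.not_dvd_of_pos_of_lt (Nat.succ_pos _) (by omega)
    have := pow_prime_pow_sub_one_mem (natCast_pow_sub_one_mem hnd) M
    rw [← pow_mul, mul_comm, ← ht] at this
    exact pPow_le (Nat.le_succ _) this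
  rw [prime_mul_bernoulli_eq, sub_right_comm]
  refine sub_mem h1 (sum_mem fun i hi => ?_)
  have hi' : i < t := Finset.mem_range.1 hi
  -- the factor `t` hidden in the binomial coefficient is divisible by `p ^ M`
  have htM : (t : ℂ_[p]) ∈ pPow p M := by
    have := intCast_mem_pPow (p := p) (n := (t : ℤ)) (k := M) (by rw [ht]; push_cast; exact dvd_mul_right _ _)
    simpa using this
  obtain ⟨n, hn⟩ : ∃ n, t - i = n + 1 := ⟨t - i - 1, by omega⟩
  obtain ⟨t', ht'⟩ : ∃ t', t = t' + 1 := ⟨t - 1, by omega⟩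
  have hch : (t.choose i : ℂ_[p]) * ((n : ℂ_[p]) + 1) = t * (t'.choose n : ℂ_[p]) := by
    have h3 : t.choose i = t.choose (n + 1) := by rw [← Nat.choose_symm hi'.le, hn]
    have h4 := Nat.add_one_mul_choose_eq t' n
    rw [h3, ht']
    exact_mod_cast h4.symm
  have hn1 : (n : ℂ_[p]) + 1 ≠ 0 := Nat.cast_add_one_ne_zero n
  have hn2 : (n : ℂ_[p]) + 1 + 1 ≠ 0 := by exact_mod_cast Nat.succ_ne_zero (n + 1)
  have h5 : ((p : ℂ_[p]) * (bernoulli i : ℚ)) * (t.choose i : ℂ_[p]) *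
        ((p : ℂ_[p]) ^ (t - i) / ((t - i + 1 : ℕ) : ℂ_[p])) =
      (((p : ℂ_[p]) * (bernoulli i : ℚ)) * (t'.choose n : ℂ_[p]) *
        ((p : ℂ_[p]) ^ (n + 1) / (((n + 1) * (n + 1 + 1) : ℕ) : ℂ_[p]))) * t := by
    rw [hn]
    push_cast
    field_simp
    linear_combination ((p : ℂ_[p]) ^ 2 * (p : ℂ_[p]) ^ n * (bernoulli i : ℂ_[p])) * hch
  rw [h5]
  exact mul_mem_pPow (mul_mem (mul_mem (prime_mul_bernoulli_mem_int i) (natCast_mem _ _))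
    (pow_div_mul_succ_mem_int (Nat.succ_ne_zero n))) htM

lemma zpow_natCast_mem_int {q : ℕ} (hq : ¬ p ∣ q) (n : ℤ) : (q : ℂ_[p]) ^ n ∈ 𝓞_ℂ_[p] := by
  obtain ⟨k, rfl | rfl⟩ := n.eq_nat_or_neg
  · rw [zpow_natCast]; exact pow_mem (natCast_mem _ _) _
  · rw [zpow_neg, zpow_natCast, ← inv_pow]; exact pow_mem (inv_natCast_mem_int hq) _

lemma prime_mul_genBernoulli_mem_int {f : ℕ} (hf : ¬ p ∣ f) (χ : DirichletCharacter ℂ_[p] f)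
    (n : ℕ) : (p : ℂ_[p]) * genBernoulli n χ ∈ 𝓞_ℂ_[p] := by
  have hf0 : f ≠ 0 := by rintro rfl; exact hf (dvd_zero p)
  have : NeZero f := ⟨hf0⟩
  rw [genBernoulli_eq_periodicBernoulli, periodicBernoulli, Finset.mul_sum]
  refine sum_mem fun a _ => ?_
  rw [mul_left_comm]
  refine mul_mem (dirichletCharacter_mem_int χ _) ?_
  rw [← zero_add (a : ℂ_[p]), scaledBernoulli_add hf0, Finset.mul_sum]
  refine sum_mem fun k _ => ?_
  rw [mul_left_comm]
  refine mul_mem (mul_mem (natCast_mem _ _) (pow_mem (natCast_mem _ _) _)) ?_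
  rw [scaledBernoulli, mul_left_comm, zero_div]
  refine mul_mem (zpow_natCast_mem_int hf _) ?_
  have h0 : Polynomial.aeval (0 : ℂ_[p]) (Polynomial.bernoulli (n - k)) =
      ((bernoulli (n - k) : ℚ) : ℂ_[p]) := by
    rw [← Polynomial.bernoulli_eval_zero, Polynomial.aeval_def, Polynomial.eval₂_at_zero,
      ← Polynomial.coeff_zero_eq_eval_zero]
    simp
  rw [h0]
  exact prime_mul_bernoulli_mem_int _

end VonStaudt

/-! ### The `p`-adic logarithm as a limit -/

section PadicLog

open Filter Topology

variable {p : ℕ} [Fact p.Prime]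

lemma tendsto_prime_pow : Tendsto (fun M : ℕ => (p : ℚ_[p]) ^ M) atTop (𝓝 0) := by
  refine tendsto_pow_atTop_nhds_zero_of_norm_lt_one ?_
  rw [Padic.norm_p]
  exact inv_lt_one_of_one_lt₀ (by exact_mod_cast (Fact.out : p.Prime).one_lt)

lemma norm_inv_natCast_le {n : ℕ} (hn : n ≠ 0) : ‖((n : ℚ_[p]))⁻¹‖ ≤ n := by
  obtain ⟨v, m, hm, rfl⟩ := Nat.exists_eq_pow_mul_and_not_dvd hn p (Fact.out : p.Prime).ne_one
  have hm0 : 1 ≤ m := Nat.one_le_iff_ne_zero.2 (by rintro rfl; exact hm (dvd_zero p))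
  have h1 : ‖(m : ℚ_[p])‖ = 1 := by
    refine le_antisymm (by simpa using Padic.norm_int_le_one (p := p) m) (not_lt.1 fun h => hm ?_)
    have := (Padic.norm_intCast_lt_one_iff (p := p) (k := m)).1 (by simpa using h)
    exact_mod_cast this
  rw [norm_inv, Nat.cast_mul, norm_mul, h1, Nat.cast_pow, norm_pow, Padic.norm_p]
  push_cast
  rw [mul_one, inv_pow, inv_inv]
  exact le_mul_of_one_le_right (by positivity) (by exact_mod_cast hm0)

lemma tendsto_choose_prime_pow_sub_one (n : ℕ) :
    Tendsto (fun M : ℕ => ((p ^ M - 1).choose n : ℚ_[p])) atTop (𝓝 ((-1) ^ n)) := by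
  have hp : p.Prime := Fact.out
  induction n with
  | zero => simp
  | succ n ih =>
    have h1 : ∀ M : ℕ, ((p ^ M - 1).choose (n + 1) : ℚ_[p]) =
        (p : ℚ_[p]) ^ M * ((n : ℚ_[p]) + 1)⁻¹ * ((p ^ M - 1).choose n : ℚ_[p]) -
          ((p ^ M - 1).choose n : ℚ_[p]) := by
      intro M
      have hM : p ^ M - 1 + 1 = p ^ M := Nat.sub_add_cancel (Nat.one_le_pow _ _ hp.pos)
      have h2 := Nat.add_one_mul_choose_eq (p ^ M - 1) n
      have h3 := Nat.choose_succ_succ (p ^ M - 1) n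
      rw [hM] at h2
      rw [Nat.succ_eq_add_one, Nat.succ_eq_add_one, hM] at h3
      rw [h3] at h2
      have h4 : (p : ℚ_[p]) ^ M * ((p ^ M - 1).choose n : ℚ_[p]) =
          (((p ^ M - 1).choose n : ℚ_[p]) + ((p ^ M - 1).choose (n + 1) : ℚ_[p])) *
            ((n : ℚ_[p]) + 1) := by exact_mod_cast h2
      have h5 : (n : ℚ_[p]) + 1 ≠ 0 := Nat.cast_add_one_ne_zero n
      field_simp
      linear_combination -h4
    have h6 := ((tendsto_prime_pow (p := p)).mul_const ((n : ℚ_[p]) + 1)⁻¹).mul ih |>.sub ih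
    simp_rw [h1]
    convert h6 using 2
    ring

/-- The logarithm is the derivative at `0` of `t ↦ κ ^ t`, taken along `t = p ^ M`. -/
lemma tendsto_padicLog {κ : ℚ_[p]} (hκ : ‖κ - 1‖ < 1) :
    Tendsto (fun M : ℕ => (κ ^ p ^ M - 1) / (p : ℚ_[p]) ^ M) atTop (𝓝 (padicLog p κ)) := by
  have hp : p.Prime := Fact.out
  set s := κ - 1 with hs
  have h1 : ∀ M : ℕ, (κ ^ p ^ M - 1) / (p : ℚ_[p]) ^ M =
      ∑' n : ℕ, ((p ^ M - 1).choose n : ℚ_[p]) * s ^ (n + 1) / ((n : ℚ_[p]) + 1) := by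
    intro M
    have hM : p ^ M - 1 + 1 = p ^ M := Nat.sub_add_cancel (Nat.one_le_pow _ _ hp.pos)
    have hpM : (p : ℚ_[p]) ^ M ≠ 0 := pow_ne_zero _ (Nat.cast_ne_zero.2 hp.ne_zero)
    rw [tsum_eq_sum (s := Finset.range (p ^ M))]
    · have h2 : κ = s + 1 := by rw [hs]; ring
      rw [h2, add_pow, Finset.sum_range_succ']
      simp only [one_pow, mul_one, pow_zero, Nat.choose_zero_right, Nat.cast_one,
        add_sub_cancel_right, Finset.sum_div]
      refine Finset.sum_congr rfl fun n _ => ?_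
      have h3 := Nat.add_one_mul_choose_eq (p ^ M - 1) n
      rw [hM] at h3
      have h4 : (p : ℚ_[p]) ^ M * ((p ^ M - 1).choose n : ℚ_[p]) =
          ((p ^ M).choose (n + 1) : ℚ_[p]) * ((n : ℚ_[p]) + 1) := by exact_mod_cast h3
      have h5 : (n : ℚ_[p]) + 1 ≠ 0 := Nat.cast_add_one_ne_zero n
      field_simp
      linear_combination -s ^ (n + 1) * h4
    · intro n hn
      rw [Nat.choose_eq_zero_of_lt]
      · simp
      · have := Finset.mem_range.not.1 hn
        have := Nat.one_le_pow M p hp.pos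
        omega
  simp_rw [h1]
  refine tendsto_tsum_of_dominated_convergence
    (bound := fun n : ℕ => ((n + 1 : ℕ) : ℝ) * ‖s‖ ^ (n + 1)) ?_ ?_ ?_
  · have := summable_pow_mul_geometric_of_norm_lt_one (R := ℝ) 1 (r := ‖s‖) (by simpa using hκ)
    simp only [pow_one] at this
    exact (summable_nat_add_iff (f := fun n : ℕ => (n : ℝ) * ‖s‖ ^ n) 1).2 this
  · intro n
    exact ((tendsto_choose_prime_pow_sub_one n).mul_const _).div_const _
  · refine Eventually.of_forall fun M n => ?_
    have h2 : ‖((p ^ M - 1).choose n : ℚ_[p])‖ ≤ 1 := by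
      simpa using Padic.norm_int_le_one (p := p) ((p ^ M - 1).choose n)
    have h3 := norm_inv_natCast_le (p := p) (Nat.succ_ne_zero n)
    rw [div_eq_mul_inv, norm_mul, norm_mul, norm_pow]
    push_cast at h3 ⊢
    calc _ ≤ 1 * ‖s‖ ^ (n + 1) * ((n : ℝ) + 1) := by gcongr
      _ = _ := by ring

lemma tendsto_one_of_tendsto_div {A : ℕ → ℚ_[p]} {a : ℚ_[p]}
    (hA : Tendsto (fun M => (A M - 1) / (p : ℚ_[p]) ^ M) atTop (𝓝 a)) :
    Tendsto A atTop (𝓝 1) := by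
  have h := (hA.mul tendsto_prime_pow).add_const 1
  rw [mul_zero, zero_add] at h
  refine h.congr fun M => ?_
  have : (p : ℚ_[p]) ^ M ≠ 0 := pow_ne_zero _ (Nat.cast_ne_zero.2 (Fact.out : p.Prime).ne_zero)
  field_simp
  ring

lemma tendsto_mul_sub_one_div {A B : ℕ → ℚ_[p]} {a b : ℚ_[p]}
    (hA : Tendsto (fun M => (A M - 1) / (p : ℚ_[p]) ^ M) atTop (𝓝 a))
    (hB : Tendsto (fun M => (B M - 1) / (p : ℚ_[p]) ^ M) atTop (𝓝 b)) :
    Tendsto (fun M => (A M * B M - 1) / (p : ℚ_[p]) ^ M) atTop (𝓝 (a + b)) := by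
  have h := (hA.mul (tendsto_one_of_tendsto_div hB)).add hB
  rw [mul_one] at h
  refine h.congr fun M => ?_
  ring

end PadicLog

/-! ### The logarithmic term -/

section LogTerm

open Filter Topology

variable {p : ℕ} [Fact p.Prime]

/-- The factor `r ^ (-t) ∏_{q ∣ r} (q - q ^ t) / (q - 1) - 1` of `B_t / t` that comes from the
trivial character; as a `p`-adic function of `t` it vanishes at `t = 0`. -/
noncomputable def eulerDefect (K : Type*) [Field K] (r t : ℕ) : K :=
  ((r : K) ^ t)⁻¹ * ∏ q ∈ r.primeFactors, ((q : K) - (q : K) ^ t) / ((q : K) - 1) - 1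

lemma genBernoulli_one_eq_bernoulli {t : ℕ} (ht : t ≠ 1) :
    genBernoulli t (1 : DirichletCharacter ℂ_[p] 1) = ((bernoulli t : ℚ) : ℂ_[p]) := by
  rw [bernoulli_eq_bernoulli'_of_ne_one ht, ← Polynomial.bernoulli_eval_one,
    ← eq_ratCast (algebraMap ℚ ℂ_[p]), ← Polynomial.aeval_algebraMap_apply_eq_algebraMap_eval]
  simp [genBernoulli, MulChar.one_apply (isUnit_of_subsingleton _)]

lemma sum_range_succ_eq_add_sum_Icc {M : Type*} [AddCommMonoid M] (g : ℕ → M) (j : ℕ) :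
    ∑ i ∈ Finset.range (j + 1), g i = g 0 + ∑ i ∈ Finset.Icc 1 j, g i := by
  rw [Finset.range_eq_Ico, Finset.sum_eq_sum_Ico_succ_bot (Nat.succ_pos _)]
  rfl

/-- `eulerDefect` cancels the pole at `t = 0`, so that the product with `B_t / t` satisfies
Kummer's congruences even along `t ≡ 0` modulo `p - 1`. -/
lemma exists_expCongr_eulerDefect {r : ℕ} (hr : ¬ p ∣ r)
    (hq : ∀ q ∈ r.primeFactors, ¬ p ∣ q - 1) {J : ℕ} (hJ : J + 1 ≤ p - 1) (I : ℕ) :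
    ∃ F : ℕ → ℂ_[p], ExpCongr p J I F ∧ ∀ i, 1 ≤ i → i ≤ I →
      F i = eulerDefect ℂ_[p] r (i * (p - 1)) *
        (genBernoulli (i * (p - 1)) (1 : DirichletCharacter ℂ_[p] 1) /
          ((i * (p - 1) : ℕ) : ℂ_[p])) := by
  set β : ℕ → ℂ_[p] := fun i => genBernoulli (i * (p - 1)) (1 : DirichletCharacter ℂ_[p] 1) /
    ((i * (p - 1) : ℕ) : ℂ_[p]) with hβ
  have hbase : ∀ c : ℕ, ¬ p ∣ c → ∃ F : ℕ → ℂ_[p], ExpCongr p J I F ∧ ∀ i, 1 ≤ i → i ≤ I →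
      F i = (1 - (c : ℂ_[p]) ^ (i * (p - 1))) * β i := by
    intro c hc
    obtain ⟨s, w, hw, h⟩ := exists_moments_one hc (I * (p - 1))
    obtain ⟨F, hF, hFi⟩ := exists_expCongr_moments s hw hJ I
    refine ⟨F, hF, fun i hi hiI => ?_⟩
    have h1 : p - 1 ≤ i * (p - 1) := Nat.le_mul_of_pos_left _ hi
    have h2 : i * (p - 1) = i * (p - 1) - 1 + 1 := by omega
    have h3 : i * (p - 1) ≤ I * (p - 1) := Nat.mul_le_mul_right _ hiI
    have h4 : ((i * (p - 1) : ℕ) : ℂ_[p]) ≠ 0 := Nat.cast_ne_zero.2 (by omega)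
    have h5 := h (i * (p - 1) - 1) (by omega)
    rw [← h2] at h5
    simp only [hβ]
    rw [hFi i hi, ← mul_div_assoc, h5, mul_div_cancel_left₀ _ h4]
  have hr0 : (r : ℂ_[p]) ≠ 0 := Nat.cast_ne_zero.2 (by rintro rfl; exact hr (dvd_zero p))
  suffices H : ∀ Q ⊆ r.primeFactors, ∃ F : ℕ → ℂ_[p], ExpCongr p J I F ∧ ∀ i, 1 ≤ i → i ≤ I →
      F i = (((r : ℂ_[p]) ^ (i * (p - 1)))⁻¹ * ∏ q ∈ Q,
        ((q : ℂ_[p]) - (q : ℂ_[p]) ^ (i * (p - 1))) / ((q : ℂ_[p]) - 1) - 1) * β i from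
    H _ subset_rfl
  intro Q
  induction Q using Finset.induction_on with
  | empty =>
    intro _
    obtain ⟨F, hF, hFi⟩ := hbase r hr
    refine ⟨_, hF.mul_exp (one_mem _) (inv_natCast_pow_sub_one_mem hr), fun i hi hiI => ?_⟩
    rw [hFi i hi hiI, ← pow_mul, mul_comm (p - 1) i, inv_pow, Finset.prod_empty]
    have := pow_ne_zero (i * (p - 1)) hr0
    field_simp
  | insert q Q hqQ ih =>
    intro hsub
    have hqr : q ∈ r.primeFactors := hsub (Finset.mem_insert_self _ _)
    obtain ⟨F, hF, hFi⟩ := ih fun x hx => hsub (Finset.mem_insert_of_mem hx)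
    have hqp : q.Prime := Nat.prime_of_mem_primeFactors hqr
    have hpq : ¬ p ∣ q := fun h => hr (h.trans (Nat.dvd_of_mem_primeFactors hqr))
    obtain ⟨G, hG, hGi⟩ := hbase q hpq
    have hq1 : ((q - 1 : ℕ) : ℂ_[p]) = (q : ℂ_[p]) - 1 := by
      rw [Nat.cast_sub hqp.one_le, Nat.cast_one]
    have hu : ((q : ℂ_[p]) - 1)⁻¹ ∈ 𝓞_ℂ_[p] := hq1 ▸ inv_natCast_mem_int (hq q hqr)
    have hu0 : (q : ℂ_[p]) - 1 ≠ 0 :=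
      hq1 ▸ Nat.cast_ne_zero.2 (by have := hqp.two_le; omega)
    -- multiplication of `A` by `(q - q ^ t) / (q - 1)` changes `A - 1` to
    -- `(A - 1) (q - q ^ t) / (q - 1) + (1 - q ^ t) / (q - 1)`
    refine ⟨_, ((hF.const_mul (mul_mem hu (natCast_mem _ q))).add
      (hF.mul_exp (neg_mem hu) (natCast_pow_sub_one_mem hpq))).add (hG.const_mul hu),
      fun i hi hiI => ?_⟩
    simp only [Pi.add_apply]
    rw [hFi i hi hiI, hGi i hi hiI, ← pow_mul, mul_comm (p - 1) i, Finset.prod_insert hqQ]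
    field_simp
    ring

lemma tendsto_prime_mul_bernoulli :
    Tendsto (fun M : ℕ => (p : ℚ_[p]) * ((bernoulli (p ^ M * (p - 1)) : ℚ) : ℚ_[p])) atTop
      (𝓝 ((p : ℚ_[p]) - 1)) := by
  have hp1 : (p : ℝ)⁻¹ < 1 := inv_lt_one_of_one_lt₀ (by exact_mod_cast (Fact.out : p.Prime).one_lt)
  rw [tendsto_iff_norm_sub_tendsto_zero]
  refine squeeze_zero (fun _ => norm_nonneg _) (fun M => ?_)
    (tendsto_pow_atTop_nhds_zero_of_lt_one (by positivity) hp1)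
  rw [← algebraMap_mem_pPow_iff]
  simpa using prime_mul_bernoulli_sub_mem (p := p) M

lemma norm_natCast_pow_sub_one_lt {q : ℕ} (hq : ¬ p ∣ q) : ‖(q : ℚ_[p]) ^ (p - 1) - 1‖ < 1 := by
  have h1 : algebraMap ℚ_[p] ℂ_[p] ((q : ℚ_[p]) ^ (p - 1) - 1) ∈ pPow p 1 := by
    simpa using natCast_pow_sub_one_mem hq
  rw [algebraMap_mem_pPow_iff, pow_one] at h1
  exact h1.trans_lt (inv_lt_one_of_one_lt₀ (by exact_mod_cast (Fact.out : p.Prime).one_lt))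

/-- The derivative of `eulerDefect` at `t = 0`. -/
lemma tendsto_eulerDefect_div {r : ℕ} (hr : ¬ p ∣ r) :
    Tendsto (fun M : ℕ => eulerDefect ℚ_[p] r (p ^ M * (p - 1)) / (p : ℚ_[p]) ^ M) atTop
      (𝓝 (-(padicLog p ((r : ℚ_[p]) ^ (p - 1)) +
        ∑ q ∈ r.primeFactors, padicLog p ((q : ℚ_[p]) ^ (p - 1)) / ((q : ℚ_[p]) - 1)))) := by
  have hlog : ∀ q : ℕ, ¬ p ∣ q → Tendsto (fun M : ℕ => ((q : ℚ_[p]) ^ (p ^ M * (p - 1)) - 1) /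
      (p : ℚ_[p]) ^ M) atTop (𝓝 (padicLog p ((q : ℚ_[p]) ^ (p - 1)))) := by
    intro q hq
    refine (tendsto_padicLog (norm_natCast_pow_sub_one_lt hq)).congr fun M => ?_
    rw [← pow_mul, mul_comm]
  have hr0 : (r : ℚ_[p]) ≠ 0 := Nat.cast_ne_zero.2 (by rintro rfl; exact hr (dvd_zero p))
  have hrlim : Tendsto (fun M : ℕ => (((r : ℚ_[p]) ^ (p ^ M * (p - 1)))⁻¹ - 1) / (p : ℚ_[p]) ^ M)
      atTop (𝓝 (-padicLog p ((r : ℚ_[p]) ^ (p - 1)))) := by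
    have h1 := ((tendsto_one_of_tendsto_div (hlog r hr)).inv₀ one_ne_zero).mul (hlog r hr)
    rw [inv_one, one_mul] at h1
    refine h1.neg.congr fun M => ?_
    have := pow_ne_zero (p ^ M * (p - 1)) hr0
    field_simp
    ring
  have hQ : ∀ Q ⊆ r.primeFactors, Tendsto (fun M : ℕ => ((∏ q ∈ Q,
      ((q : ℚ_[p]) - (q : ℚ_[p]) ^ (p ^ M * (p - 1))) / ((q : ℚ_[p]) - 1)) - 1) /
        (p : ℚ_[p]) ^ M) atTop
      (𝓝 (-∑ q ∈ Q, padicLog p ((q : ℚ_[p]) ^ (p - 1)) / ((q : ℚ_[p]) - 1))) := by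
    intro Q
    induction Q using Finset.induction_on with
    | empty => intro _; simp
    | insert q Q hqQ ih =>
      intro hsub
      have hqr : q ∈ r.primeFactors := hsub (Finset.mem_insert_self _ _)
      have hqp : q.Prime := Nat.prime_of_mem_primeFactors hqr
      have hu0 : (q : ℚ_[p]) - 1 ≠ 0 := by
        rw [sub_ne_zero]; exact_mod_cast hqp.ne_one
      have h1 := (hlog q fun h => hr (h.trans (Nat.dvd_of_mem_primeFactors hqr))).div_const
        ((q : ℚ_[p]) - 1) |>.neg
      have h2 : Tendsto (fun M : ℕ => (((q : ℚ_[p]) - (q : ℚ_[p]) ^ (p ^ M * (p - 1))) /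
          ((q : ℚ_[p]) - 1) - 1) / (p : ℚ_[p]) ^ M) atTop
          (𝓝 (-(padicLog p ((q : ℚ_[p]) ^ (p - 1)) / ((q : ℚ_[p]) - 1)))) := by
        refine h1.congr fun M => ?_
        field_simp
        ring
      have h3 := tendsto_mul_sub_one_div h2 (ih fun x hx => hsub (Finset.mem_insert_of_mem hx))
      rw [← neg_add] at h3
      simpa only [Finset.prod_insert hqQ, Finset.sum_insert hqQ] using h3
  have h := tendsto_mul_sub_one_div hrlim (hQ _ subset_rfl)
  rw [← neg_add] at h
  exact h

/-- The contribution of the trivial character to the case `m = 1`: by Kummer's congruences the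
alternating sum is the negative of the value at `t = 0`, which is the limit along
`t = p ^ M (p - 1)`. -/
lemma sum_eulerDefect_sub_mem {r : ℕ} (hr : ¬ p ∣ r) (hq : ∀ q ∈ r.primeFactors, ¬ p ∣ q - 1)
    {j : ℕ} (hj0 : 0 < j) (hj : j + 1 ≤ p - 1) :
    ∑ i ∈ Finset.Icc 1 j, (-1) ^ i * (j.choose i : ℂ_[p]) *
        (eulerDefect ℂ_[p] r (i * (p - 1)) *
          (genBernoulli (i * (p - 1)) (1 : DirichletCharacter ℂ_[p] 1) /
            ((i * (p - 1) : ℕ) : ℂ_[p]))) -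
      algebraMap ℚ_[p] ℂ_[p] (1 / (p : ℚ_[p]) *
        (padicLog p ((r : ℚ_[p]) ^ (p - 1)) +
          ∑ q ∈ r.primeFactors, padicLog p ((q : ℚ_[p]) ^ (p - 1)) / ((q : ℚ_[p]) - 1))) ∈
      pPow p j := by
  have hp : p.Prime := Fact.out
  set L : ℚ_[p] := padicLog p ((r : ℚ_[p]) ^ (p - 1)) +
    ∑ q ∈ r.primeFactors, padicLog p ((q : ℚ_[p]) ^ (p - 1)) / ((q : ℚ_[p]) - 1) with hL
  have hpQ : (p : ℚ_[p]) ≠ 0 := Nat.cast_ne_zero.2 hp.ne_zero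
  have hp1 : ((p - 1 : ℕ) : ℚ_[p]) = (p : ℚ_[p]) - 1 := by rw [Nat.cast_sub hp.one_le, Nat.cast_one]
  have hp10 : (p : ℚ_[p]) - 1 ≠ 0 := hp1 ▸ Nat.cast_ne_zero.2 (by have := hp.two_le; omega)
  have hlim : Tendsto (fun M : ℕ => eulerDefect ℚ_[p] r (p ^ M * (p - 1)) *
      (((bernoulli (p ^ M * (p - 1)) : ℚ) : ℚ_[p]) / ((p ^ M * (p - 1) : ℕ) : ℚ_[p])))
      atTop (𝓝 (-(1 / (p : ℚ_[p]) * L))) := by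
    have h1 := ((tendsto_eulerDefect_div hr).mul (tendsto_prime_mul_bernoulli (p := p))).div_const
      ((p : ℚ_[p]) * ((p : ℚ_[p]) - 1))
    rw [← hL] at h1
    have h2 : -L * ((p : ℚ_[p]) - 1) / ((p : ℚ_[p]) * ((p : ℚ_[p]) - 1)) =
        -(1 / (p : ℚ_[p]) * L) := by
      field_simp
    rw [h2] at h1
    refine h1.congr fun M => ?_
    rw [Nat.cast_mul, hp1, Nat.cast_pow]
    field_simp
  have hpj : (0 : ℝ) < (p : ℝ)⁻¹ ^ j := by
    have : (0 : ℝ) < p := Nat.cast_pos.2 hp.pos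
    positivity
  obtain ⟨M, hM, hMj⟩ := ((hlim.eventually (Metric.closedBall_mem_nhds _ hpj)).and
    (eventually_ge_atTop j)).exists
  rw [dist_eq_norm, sub_neg_eq_add, ← algebraMap_mem_pPow_iff, map_add] at hM
  have hjI : j ≤ p ^ M := hMj.trans (Nat.lt_pow_self hp.one_lt).le
  obtain ⟨F, hF, hFi⟩ := exists_expCongr_eulerDefect hr hq hj (p ^ M)
  have h1 := hF.sum_choose_mul_mem hjI le_rfl
  have h2 := hF.prime_pow_sub_zero_mem le_rfl (hMj.trans (Nat.le_succ M))
  rw [sum_range_succ_eq_add_sum_Icc] at h1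
  have h3 : F (p ^ M) = algebraMap ℚ_[p] ℂ_[p] (eulerDefect ℚ_[p] r (p ^ M * (p - 1)) *
      (((bernoulli (p ^ M * (p - 1)) : ℚ) : ℚ_[p]) / ((p ^ M * (p - 1) : ℕ) : ℚ_[p]))) := by
    have h4 : p ^ M * (p - 1) ≠ 1 := by
      intro h
      have := (mul_eq_one.1 h).2
      omega
    rw [hFi _ (Nat.one_le_pow _ _ hp.pos) le_rfl, genBernoulli_one_eq_bernoulli h4]
    simp [eulerDefect]
  have h5 : ∑ i ∈ Finset.Icc 1 j, (-1) ^ i * (j.choose i : ℂ_[p]) * F i =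
      ∑ i ∈ Finset.Icc 1 j, (-1) ^ i * (j.choose i : ℂ_[p]) *
        (eulerDefect ℂ_[p] r (i * (p - 1)) *
          (genBernoulli (i * (p - 1)) (1 : DirichletCharacter ℂ_[p] 1) /
            ((i * (p - 1) : ℕ) : ℂ_[p]))) := by
    refine Finset.sum_congr rfl fun i hi => ?_
    have hi' := Finset.mem_Icc.1 hi
    rw [hFi i hi'.1 (hi'.2.trans hjI)]
  rw [← h5]
  rw [← h3] at hM
  convert sub_mem (add_mem h1 h2) hM using 1
  simp
  ring

end LogTerm

/-! ### The sum of negative powers in terms of generalized Bernoulli numbers -/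

section Lehmer

lemma prime_sub_one_le_mul {p i : ℕ} (hi : 1 ≤ i) : p - 1 ≤ i * (p - 1) :=
  Nat.le_mul_of_pos_left _ hi

lemma prime_not_dvd_of_mem_primeFactors {p f r q : ℕ} (hr : ¬ p ∣ r) (hf : f ∣ r)
    (hq : q ∈ (r / f).primeFactors) : ¬ p ∣ q := fun h =>
  hr (h.trans ((Nat.dvd_of_mem_primeFactors hq).trans (Nat.div_dvd_of_dvd hf)))

variable {p : ℕ} [Fact p.Prime]

/-- `k ^ (-m)` is replaced by positive powers with the binomial expansion of
`k ^ (-m) * (1 - k ^ (p - 1)) ^ j ≡ 0`; the multiples of `p` only contribute multiples of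
`p ^ j`. -/
lemma lehmerSum_add_mem (d r : ℕ) {m j : ℕ} (hjm : j + m ≤ p - 1) :
    lehmerSum p d r m + ∑ i ∈ Finset.Icc 1 j, (-1) ^ i * (j.choose i : ℂ_[p]) *
      ∑ k ∈ Finset.Icc 1 (d * p / r), (k : ℂ_[p]) ^ (i * (p - 1) - m) ∈ pPow p j := by
  have hp : p.Prime := Fact.out
  simp_rw [Finset.mul_sum]
  rw [Finset.sum_comm, lehmerSum, Finset.sum_filter, ← Finset.sum_add_distrib]
  refine sum_mem fun k _ => ?_
  by_cases hk : p ∣ k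
  · have hk' : ¬ k.Coprime p := fun h => hp.not_dvd_one (h ▸ Nat.dvd_gcd hk dvd_rfl)
    rw [if_neg hk', zero_add]
    refine sum_mem fun i hi => ?_
    have hk1 : (k : ℂ_[p]) ∈ pPow p 1 := by
      have := intCast_mem_pPow (p := p) (n := (k : ℤ)) (k := 1)
        (by rw [pow_one]; exact_mod_cast hk)
      simpa using this
    have := prime_sub_one_le_mul (p := p) (Finset.mem_Icc.1 hi).1
    refine mul_mem_pPow (mul_mem (pow_mem (neg_mem (one_mem _)) _) (natCast_mem _ _))
      (pPow_le ?_ (pow_mem_pPow_of_mem hk1 _))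
    omega
  · have hk' : k.Coprime p := ((Nat.Prime.coprime_iff_not_dvd hp).2 hk).symm
    have hk0 : (k : ℂ_[p]) ≠ 0 := Nat.cast_ne_zero.2 (by rintro rfl; exact hk (dvd_zero p))
    have h := (ExpCongr.exp (J := j) (I := j) (pow_mem (inv_natCast_mem_int hk) m)
      (natCast_pow_sub_one_mem hk)).sum_choose_mul_mem le_rfl le_rfl
    rw [sum_range_succ_eq_add_sum_Icc] at h
    rw [if_pos hk']
    convert h using 2
    · simp
    · refine Finset.sum_congr rfl fun i hi => ?_
      have := prime_sub_one_le_mul (p := p) (Finset.mem_Icc.1 hi).1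
      rw [← pow_mul, mul_comm (p - 1) i]
      congr 1
      rw [inv_pow, eq_inv_mul_iff_mul_eq₀ (pow_ne_zero _ hk0), ← pow_add]
      congr 1
      omega

lemma eulerD_mem_int {f r : ℕ} [NeZero f] (hr : ¬ p ∣ r) (hf : f ∣ r)
    (ψ : DirichletCharacter ℂ_[p] f) (n : ℤ) : eulerD ψ r n ∈ 𝓞_ℂ_[p] :=
  prod_mem fun _ hq => sub_mem (one_mem _) (mul_mem (dirichletCharacter_mem_int ψ _)
    (zpow_natCast_mem_int (prime_not_dvd_of_mem_primeFactors hr hf hq) n))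

lemma ExpCongr.prod_mul {J I : ℕ} {F : ℕ → ℂ_[p]} (hF : ExpCongr p J I F) (Q : Finset ℕ)
    {a y : ℕ → ℂ_[p]} (ha : ∀ q ∈ Q, a q ∈ 𝓞_ℂ_[p]) (hy : ∀ q ∈ Q, y q - 1 ∈ pPow p 1) :
    ExpCongr p J I fun i => (∏ q ∈ Q, (1 - a q * y q ^ i)) * F i := by
  induction Q using Finset.induction_on with
  | empty => simpa using hF
  | insert q Q hq ih =>
    have h1 := ih (fun x hx => ha x (Finset.mem_insert_of_mem hx))
      fun x hx => hy x (Finset.mem_insert_of_mem hx)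
    have h2 := h1.add (h1.mul_exp (neg_mem (ha q (Finset.mem_insert_self _ _)))
      (hy q (Finset.mem_insert_self _ _)))
    convert h2 using 1
    ext i
    simp only [Pi.add_apply, Finset.prod_insert hq]
    ring

lemma eq_one_of_isPrimitive_one {f : ℕ} [NeZero f] {ψ : DirichletCharacter ℂ_[p] f}
    (hψ : ψ.IsPrimitive) (h : ψ = 1) : f = 1 := by
  have h1 : ψ.conductor = f := hψ
  rw [← h1]
  exact DirichletCharacter.eq_one_iff_conductor_eq_one.1 h

/-- Kummer's congruences for a primitive character, the pole of the zeta function excluded. -/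
lemma exists_expCongr_of_isPrimitive {f : ℕ} (hf : ¬ p ∣ f) {ψ : DirichletCharacter ℂ_[p] f}
    (hψ : ψ.IsPrimitive) {J m : ℕ} (h : ψ ≠ 1 ∨ 2 ≤ m) (hJ : J + m ≤ p - 1) (I : ℕ) :
    ∃ F : ℕ → ℂ_[p], ExpCongr p J I F ∧ ∀ i, 1 ≤ i → i ≤ I →
      F i = genBernoulli (i * (p - 1) + 1 - m) ψ / ((i * (p - 1) + 1 - m : ℕ) : ℂ_[p]) := by
  have : NeZero f := ⟨by rintro rfl; exact hf (dvd_zero p)⟩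
  by_cases h1 : ψ = 1
  · obtain rfl := eq_one_of_isPrimitive_one hψ h1
    subst h1
    exact exists_expCongr_genBernoulli_one (h.resolve_left (by simp)) hJ I
  · exact exists_expCongr_genBernoulli hf h1 hJ I

lemma bernoulliB_add_mem {f k m I : ℕ} {ψ : DirichletCharacter ℂ_[p] f} {F : ℕ → ℂ_[p]}
    (hF : ExpCongr p k I F) (hFi : ∀ i, 1 ≤ i → i ≤ I →
      F i = genBernoulli (i * (p - 1) + 1 - m) ψ / ((i * (p - 1) + 1 - m : ℕ) : ℂ_[p]))
    (hk : k ≤ I) : bernoulliB p m k ψ + F 0 ∈ pPow p k := by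
  have h := hF.sum_choose_mul_mem hk le_rfl
  rw [sum_range_succ_eq_add_sum_Icc] at h
  convert h using 1
  rw [add_comm, bernoulliB]
  congr 1
  · simp
  · refine Finset.sum_congr rfl fun i hi => ?_
    have hi' := Finset.mem_Icc.1 hi
    rw [hFi i hi'.1 (hi'.2.trans hk)]

lemma bernoulliK_add_mem {f k m I : ℕ} {ψ : DirichletCharacter ℂ_[p] f} {F : ℕ → ℂ_[p]}
    (hF : ExpCongr p k I F) (hFi : ∀ i, 1 ≤ i → i ≤ I →
      F i = genBernoulli (i * (p - 1) + 1 - m) ψ / ((i * (p - 1) + 1 - m : ℕ) : ℂ_[p]))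
    (hk : p ^ (k - 1) ≤ I) : bernoulliK p m k ψ + F 0 ∈ pPow p k := by
  have h := neg_mem (hF.prime_pow_sub_zero_mem hk (by omega))
  rw [hFi _ (Nat.one_le_pow _ _ (Fact.out : p.Prime).pos) hk] at h
  convert h using 1
  rw [bernoulliK]
  ring

/-- The contribution of a character `ψ`, of the `n`-th power of `N` and of the exponent
`i (p - 1) - m` to the sum of powers. -/
noncomputable def lehmerTerm (p : ℕ) [Fact p.Prime] (r N m n i : ℕ) {f : ℕ}
    (ψ : DirichletCharacter ℂ_[p] f) : ℂ_[p] :=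
  ((r : ℂ_[p]) ^ (i * (p - 1) - m))⁻¹ * ((i * (p - 1) - m).choose n : ℂ_[p]) * (N : ℂ_[p]) ^ n *
    eulerD ψ r (((i * (p - 1) + 1 - (m + n) : ℕ) : ℤ) - 1) *
      (genBernoulli (i * (p - 1) + 1 - (m + n)) ψ / ((i * (p - 1) + 1 - (m + n) : ℕ) : ℂ_[p]))

/-- The alternating sum over `i` of the contributions is the negative of their interpolated value
at `i = 0`, that is, at the exponent `-m`. -/
lemma sum_lehmerTerm_sub_mem {r d m n j f : ℕ} (hr : ¬ p ∣ r) (hf : f ∣ r)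
    {ψ : DirichletCharacter ℂ_[p] f} (hψ : ψ.IsPrimitive) (h : ψ ≠ 1 ∨ 2 ≤ m + n) (hn : n < j)
    (hjm : j + m ≤ p - 1) {X : ℂ_[p]}
    (hX : X = bernoulliB p (m + n) (j - n) ψ ∨ X = bernoulliK p (m + n) (j - n) ψ) :
    ∑ i ∈ Finset.Icc 1 j, (-1) ^ i * (j.choose i : ℂ_[p]) * lehmerTerm p r (d * p) m n i ψ -
      (r : ℂ_[p]) ^ m * ((Ring.choose (-(m : ℤ)) n : ℤ) : ℂ_[p]) * ((d * p : ℕ) : ℂ_[p]) ^ n *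
        eulerD ψ r (-(m : ℤ) - n) * X ∈ pPow p j := by
  have hp : p.Prime := Fact.out
  have hpf : ¬ p ∣ f := fun h => hr (h.trans hf)
  have : NeZero f := ⟨by rintro rfl; exact hpf (dvd_zero p)⟩
  have hr0 : (r : ℂ_[p]) ≠ 0 := Nat.cast_ne_zero.2 (by rintro rfl; exact hr (dvd_zero p))
  have hjI : j ≤ p ^ j := (Nat.lt_pow_self hp.one_lt).le
  obtain ⟨F, hF, hFi⟩ := exists_expCongr_of_isPrimitive hpf hψ h
    (J := j - n) (by omega) (p ^ j)
  have hXF : X + F 0 ∈ pPow p (j - n) := by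
    rcases hX with rfl | rfl
    · exact bernoulliB_add_mem hF hFi (by omega)
    · exact bernoulliK_add_mem hF hFi (Nat.pow_le_pow_right hp.pos (by omega))
  have hG := (hF.prod_mul (r / f).primeFactors
    (a := fun q => ψ (q : ZMod f) * (q : ℂ_[p]) ^ (-(m : ℤ) - n))
    (y := fun q => (q : ℂ_[p]) ^ (p - 1))
    (fun q hq => mul_mem (dirichletCharacter_mem_int ψ _)
      (zpow_natCast_mem_int (prime_not_dvd_of_mem_primeFactors hr hf hq) _))
    (fun q hq => natCast_pow_sub_one_mem (prime_not_dvd_of_mem_primeFactors hr hf hq))).mul_exp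
    (pow_mem (natCast_mem _ r) m) (inv_natCast_pow_sub_one_mem hr)
  set G : ℕ → ℂ_[p] := fun i => (r : ℂ_[p]) ^ m * ((r : ℂ_[p])⁻¹ ^ (p - 1)) ^ i *
    ((∏ q ∈ (r / f).primeFactors, (1 - ψ (q : ZMod f) * (q : ℂ_[p]) ^ (-(m : ℤ) - n) *
      ((q : ℂ_[p]) ^ (p - 1)) ^ i)) * F i) with hGdef
  have hG0 : G 0 = (r : ℂ_[p]) ^ m * eulerD ψ r (-(m : ℤ) - n) * F 0 := by
    simp [hGdef, eulerD, mul_assoc]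
  have hsum := hG.sum_choose_ringChoose_mul_mem ((p - 1 : ℕ) : ℤ) (-(m : ℤ)) (n := n) (j := j)
    (by omega) hjI le_rfl
  rw [sum_range_succ_eq_add_sum_Icc] at hsum
  have hNn : ((d * p : ℕ) : ℂ_[p]) ^ n ∈ pPow p n := by
    rw [Nat.cast_mul, mul_pow]
    exact mul_mem_pPow (pow_mem (natCast_mem _ _) _) (pow_mem_pPow n)
  have hterm : ∀ i ∈ Finset.Icc 1 j, lehmerTerm p r (d * p) m n i ψ =
      ((d * p : ℕ) : ℂ_[p]) ^ n *
        (((Ring.choose (((p - 1 : ℕ) : ℤ) * i + -(m : ℤ)) n : ℤ) : ℂ_[p]) * G i) := by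
    intro i hi
    have hi' := Finset.mem_Icc.1 hi
    have hle := prime_sub_one_le_mul (p := p) hi'.1
    have h1 : ((p - 1 : ℕ) : ℤ) * i + -(m : ℤ) = ((i * (p - 1) - m : ℕ) : ℤ) := by
      have : ((i * (p - 1) - m : ℕ) : ℤ) = i * ((p - 1 : ℕ) : ℤ) - m := by
        rw [Nat.cast_sub (by omega), Nat.cast_mul]
      rw [this]
      ring
    have h2 : ((r : ℂ_[p]) ^ (i * (p - 1) - m))⁻¹ =
        (r : ℂ_[p]) ^ m * ((r : ℂ_[p])⁻¹ ^ (p - 1)) ^ i := by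
      rw [← pow_mul, inv_pow, mul_comm (p - 1) i, inv_eq_iff_eq_inv, mul_inv, inv_inv,
        eq_inv_mul_iff_mul_eq₀ (pow_ne_zero _ hr0), ← pow_add]
      congr 1
      omega
    have h3 : eulerD ψ r (((i * (p - 1) + 1 - (m + n) : ℕ) : ℤ) - 1) =
        ∏ q ∈ (r / f).primeFactors, (1 - ψ (q : ZMod f) * (q : ℂ_[p]) ^ (-(m : ℤ) - n) *
          ((q : ℂ_[p]) ^ (p - 1)) ^ i) := by
      refine Finset.prod_congr rfl fun q hq => ?_
      have hq0 : (q : ℂ_[p]) ≠ 0 := Nat.cast_ne_zero.2 (Nat.prime_of_mem_primeFactors hq).ne_zero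
      rw [mul_assoc, ← pow_mul, ← zpow_natCast, ← zpow_add₀ hq0]
      congr 3
      have : ((i * (p - 1) + 1 - (m + n) : ℕ) : ℤ) = i * ((p - 1 : ℕ) : ℤ) + 1 - (m + n) := by
        rw [Nat.cast_sub (by omega)]
        push_cast
        ring
      rw [this]
      push_cast
      ring
    rw [lehmerTerm, h1, Ring.choose_natCast, h2, h3, ← hFi i hi'.1 (hi'.2.trans hjI), hGdef]
    push_cast
    ring
  rw [Finset.sum_congr rfl fun i hi => congrArg _ (hterm i hi)]
  have e1 := mul_mem_pPow_add hNn hsum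
  have e2 := mul_mem_pPow_add hNn (mul_mem_pPow (mul_mem (mul_mem (pow_mem (natCast_mem _ r) m)
    (intCast_mem _ (Ring.choose (-(m : ℤ)) n))) (eulerD_mem_int hr hf ψ (-(m : ℤ) - n))) hXF)
  rw [Nat.add_sub_cancel' hn.le] at e1 e2
  convert sub_mem e1 e2 using 1
  rw [hG0, mul_add, Finset.mul_sum]
  simp only [Nat.cast_zero, mul_zero, zero_add, pow_zero, Nat.choose_zero_right, Nat.cast_one,
    one_mul]
  rw [Finset.sum_congr rfl fun i _ => show (-1) ^ i * (j.choose i : ℂ_[p]) *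
    (((d * p : ℕ) : ℂ_[p]) ^ n *
      (((Ring.choose (((p - 1 : ℕ) : ℤ) * i + -(m : ℤ)) n : ℤ) : ℂ_[p]) * G i)) =
    ((d * p : ℕ) : ℂ_[p]) ^ n * ((-1) ^ i * (j.choose i : ℂ_[p]) *
      ((Ring.choose (((p - 1 : ℕ) : ℤ) * i + -(m : ℤ)) n : ℤ) : ℂ_[p]) * G i) by ring]
  ring

/-- Integrality of the Bernoulli numbers of a possibly imprimitive character, away from the indices
divisible by `p - 1`. -/
lemma genBernoulli_mem_int {r : ℕ} (hr : ¬ p ∣ r) (χ : DirichletCharacter ℂ_[p] r) {i m : ℕ}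
    (hi : 1 ≤ i) (hm2 : 2 ≤ m) (hm : m ≤ p - 1) :
    genBernoulli (i * (p - 1) + 1 - m) χ ∈ 𝓞_ℂ_[p] := by
  have hr0 : r ≠ 0 := by rintro rfl; exact hr (dvd_zero p)
  have : NeZero r := ⟨hr0⟩
  have hle := prime_sub_one_le_mul (p := p) hi
  have hcancel : ∀ {x : ℂ_[p]}, x / ((i * (p - 1) + 1 - m : ℕ) : ℂ_[p]) ∈ 𝓞_ℂ_[p] →
      x ∈ 𝓞_ℂ_[p] := by
    intro x hx
    have h0 : ((i * (p - 1) + 1 - m : ℕ) : ℂ_[p]) ≠ 0 := Nat.cast_ne_zero.2 (by omega)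
    have := mul_mem hx (natCast_mem 𝓞_ℂ_[p] (i * (p - 1) + 1 - m))
    rwa [div_mul_cancel₀ _ h0] at this
  by_cases hχ : χ = 1
  · subst hχ
    rw [← map_one (DirichletCharacter.changeLevel (one_dvd r)), genBernoulli_changeLevel hr0]
    obtain ⟨F, hF, hFi⟩ := exists_expCongr_genBernoulli_one (p := p) (J := 0) hm2 (by omega) i
    refine mul_mem (eulerD_mem_int hr (one_dvd r) _ _) (hcancel ?_)
    rw [← hFi i hi le_rfl]
    exact hF.mem_int le_rfl
  · obtain ⟨F, hF, hFi⟩ := exists_expCongr_genBernoulli hr hχ (J := 0) (m := m) (by omega) i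
    refine hcancel ?_
    rw [← hFi i hi le_rfl]
    exact hF.mem_int le_rfl

end Lehmer

section Assembly

variable {p : ℕ} [Fact p.Prime]

lemma changeLevel_inv_neg_natCast {f r N : ℕ} (h : f ∣ r) (hN : N.Coprime r)
    (ψ : DirichletCharacter ℂ_[p] f) :
    (DirichletCharacter.changeLevel h ψ)⁻¹ (-(N : ZMod r)) = ψ⁻¹ (-(N : ZMod f)) := by
  have h1 := DirichletCharacter.changeLevel_eq_cast_of_dvd' ψ⁻¹ h (a := -(N : ℤ))
    (Nat.isCoprime_iff_coprime.2 hN).neg_left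
  rw [map_inv] at h1
  simpa using h1

open Classical in
/-- The power sum with exponent `i (p - 1) - m`, modulo `p ^ j`. Only the powers `N ^ n` with
`n < j` survive: for `n > j` the factor `p ^ n` makes up for the possible denominator `p` of the
Bernoulli number, and for `n = j` the Bernoulli number is integral because `j + m < p`. -/
lemma sum_pow_sub_mem {d r m j i : ℕ} (hr : ¬ p ∣ r) (hφ : ¬ p ∣ r.totient)
    (hcop : (d * p).Coprime r) (hm : 0 < m) (hjm : j + m ≤ p - 1) (hi : 1 ≤ i) (hij : i ≤ j) :
    ∑ k ∈ Finset.Icc 1 (d * p / r), (k : ℂ_[p]) ^ (i * (p - 1) - m) -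
      (-(genBernoulli (i * (p - 1) + 1 - m) (1 : DirichletCharacter ℂ_[p] 1) /
          ((i * (p - 1) + 1 - m : ℕ) : ℂ_[p])) +
        (r.totient : ℂ_[p])⁻¹ * ∑ f ∈ r.divisors,
          ∑ ψ : DirichletCharacter ℂ_[p] f with ψ.IsPrimitive,
            ψ⁻¹ (-((d * p : ℕ) : ZMod f)) *
              ∑ n ∈ Finset.range j, lehmerTerm p r (d * p) m n i ψ) ∈ pPow p j := by
  have hp : p.Prime := Fact.out
  have hr0 : r ≠ 0 := by rintro rfl; exact hr (dvd_zero p)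
  have : NeZero r := ⟨hr0⟩
  have hle := prime_sub_one_le_mul (p := p) hi
  set N := d * p with hN
  obtain ⟨s, hs⟩ : ∃ s, s = i * (p - 1) - m := ⟨_, rfl⟩
  have hs1 : i * (p - 1) + 1 - m = s + 1 := by omega
  have hsn : ∀ n, i * (p - 1) + 1 - (m + n) = s + 1 - n := fun n => by omega
  have hsj : j ≤ s := by omega
  have hs0 : ((s + 1 : ℕ) : ℂ_[p]) ≠ 0 := Nat.cast_ne_zero.2 (Nat.succ_ne_zero s)
  have hsp : ¬ p ∣ s + 1 := by
    intro h
    have h1 : i + m - 1 = i * p - (s + 1) := by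
      have : i * p = i * (p - 1) + i := by
        rw [← Nat.mul_succ]; congr 1; have := hp.pos; omega
      omega
    have h2 : p ∣ i + m - 1 := h1 ▸ Nat.dvd_sub (dvd_mul_left p i) h
    have := Nat.le_of_dvd (by omega) h2
    omega
  set Gχ : DirichletCharacter ℂ_[p] r → ℂ_[p] := fun χ => χ⁻¹ (-(N : ZMod r)) *
    ∑ n ∈ Finset.range j, ((r : ℂ_[p]) ^ s)⁻¹ * (s.choose n : ℂ_[p]) * (N : ℂ_[p]) ^ n *
      (genBernoulli (s + 1 - n) χ / ((s + 1 - n : ℕ) : ℂ_[p])) with hGχ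
  have hprim := sum_dirichletCharacter_eq_sum_primitive Gχ (fun f ψ => ψ⁻¹ (-((N : ℕ) : ZMod f)) *
      ∑ n ∈ Finset.range j, lehmerTerm p r N m n i ψ) (by
    intro f h ψ _
    simp only [hGχ]
    rw [changeLevel_inv_neg_natCast h hcop]
    congr 1
    refine Finset.sum_congr rfl fun n _ => ?_
    rw [lehmerTerm, hsn, ← hs, genBernoulli_changeLevel hr0]
    ring)
  have htail : ∀ χ : DirichletCharacter ℂ_[p] r, ∑ n ∈ Finset.Ico j (s + 2),
      ((s + 1).choose n : ℂ_[p]) * (N : ℂ_[p]) ^ n * genBernoulli (s + 1 - n) χ ∈ pPow p j := by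
    intro χ
    refine sum_mem fun n hn => ?_
    have hn' := Finset.mem_Ico.1 hn
    rw [hN, Nat.cast_mul, mul_pow]
    rcases hn'.1.eq_or_lt with rfl | hlt
    · rw [← hsn, ← mul_assoc]
      exact mul_mem_pPow' (mul_mem_pPow (mul_mem (natCast_mem _ _) (pow_mem (natCast_mem _ _) _))
        (pow_mem_pPow _)) (genBernoulli_mem_int hr χ hi (by omega) (by omega))
    · obtain ⟨k, rfl⟩ : ∃ k, n = k + 1 := ⟨n - 1, by omega⟩
      have h1 : ((s + 1).choose (k + 1) : ℂ_[p]) * ((d : ℂ_[p]) ^ (k + 1) * (p : ℂ_[p]) ^ (k + 1)) *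
          genBernoulli (s + 1 - (k + 1)) χ =
        ((s + 1).choose (k + 1) : ℂ_[p]) * (d : ℂ_[p]) ^ (k + 1) * (p : ℂ_[p]) ^ k *
          ((p : ℂ_[p]) * genBernoulli (s + 1 - (k + 1)) χ) := by ring
      rw [h1]
      exact mul_mem_pPow' (mul_mem_pPow (mul_mem (natCast_mem _ _) (pow_mem (natCast_mem _ _) _))
        (pPow_le (by omega) (pow_mem_pPow k))) (prime_mul_genBernoulli_mem_int hr χ _)
  have hGs : ∀ χ : DirichletCharacter ℂ_[p] r, ((s + 1 : ℕ) : ℂ_[p]) * Gχ χ =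
      χ⁻¹ (-(N : ZMod r)) * (((r : ℂ_[p]) ^ s)⁻¹ * ∑ n ∈ Finset.range j,
        ((s + 1).choose n : ℂ_[p]) * (N : ℂ_[p]) ^ n * genBernoulli (s + 1 - n) χ) := by
    intro χ
    simp only [hGχ]
    rw [mul_left_comm]
    congr 1
    rw [Finset.mul_sum, Finset.mul_sum]
    refine Finset.sum_congr rfl fun n hn => ?_
    have hn' := Finset.mem_range.1 hn
    have h1 : (s.choose n : ℂ_[p]) * ((s + 1 : ℕ) : ℂ_[p]) =
        ((s + 1).choose n : ℂ_[p]) * ((s + 1 - n : ℕ) : ℂ_[p]) := by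
      exact_mod_cast Nat.choose_mul_succ_eq s n
    have h2 : ((s + 1 - n : ℕ) : ℂ_[p]) ≠ 0 := Nat.cast_ne_zero.2 (by omega)
    rw [mul_div_assoc', mul_div_assoc', div_eq_iff h2]
    linear_combination (((r : ℂ_[p]) ^ s)⁻¹ * (N : ℂ_[p]) ^ n * genBernoulli (s + 1 - n) χ) * h1
  rw [hs1, ← hs, ← hprim]
  refine mem_pPow_of_mul hs0 (inv_natCast_mem_int hsp) ?_
  have hformula := sum_pow_div_eq (K := ℂ_[p]) (r := r) (N := N) (s := s) hcop
  have hsplit : ∀ χ : DirichletCharacter ℂ_[p] r, ∑ n ∈ Finset.range (s + 2),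
      ((s + 1).choose n : ℂ_[p]) * (N : ℂ_[p]) ^ n * genBernoulli (s + 1 - n) χ =
      ∑ n ∈ Finset.range j, ((s + 1).choose n : ℂ_[p]) * (N : ℂ_[p]) ^ n *
        genBernoulli (s + 1 - n) χ + ∑ n ∈ Finset.Ico j (s + 2),
      ((s + 1).choose n : ℂ_[p]) * (N : ℂ_[p]) ^ n * genBernoulli (s + 1 - n) χ :=
    fun χ => (Finset.sum_range_add_sum_Ico _ (by omega)).symm
  have hrest : ((r : ℂ_[p]) ^ s * (r.totient : ℂ_[p]))⁻¹ *
      ∑ χ : DirichletCharacter ℂ_[p] r, χ⁻¹ (-(N : ZMod r)) * ∑ n ∈ Finset.Ico j (s + 2),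
      ((s + 1).choose n : ℂ_[p]) * (N : ℂ_[p]) ^ n * genBernoulli (s + 1 - n) χ ∈ pPow p j := by
    refine mul_mem_pPow ?_ (sum_mem fun χ _ => mul_mem_pPow (dirichletCharacter_mem_int _ _)
      (htail χ))
    rw [mul_inv, ← inv_pow]
    exact mul_mem (pow_mem (inv_natCast_mem_int hr) _) (inv_natCast_mem_int hφ)
  have hG : ((s + 1 : ℕ) : ℂ_[p]) * ∑ χ, Gχ χ = ((r : ℂ_[p]) ^ s)⁻¹ *
      ∑ χ : DirichletCharacter ℂ_[p] r, χ⁻¹ (-(N : ZMod r)) * ∑ n ∈ Finset.range j,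
        ((s + 1).choose n : ℂ_[p]) * (N : ℂ_[p]) ^ n * genBernoulli (s + 1 - n) χ := by
    rw [Finset.mul_sum, Finset.mul_sum]
    exact Finset.sum_congr rfl fun χ _ => by rw [hGs]; ring
  simp_rw [hsplit, mul_add, Finset.sum_add_distrib, mul_add] at hformula
  convert hrest using 1
  rw [mul_sub, hformula, mul_add, mul_neg, mul_div_cancel₀ _ hs0, mul_left_comm, hG, mul_inv]
  ring

open Classical in
/-- The power sums combined: the alternating sums over `i` now stand next to each character. -/
lemma lehmerSum_sub_mem {d r m j : ℕ} (hr : ¬ p ∣ r) (hφ : ¬ p ∣ r.totient)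
    (hcop : (d * p).Coprime r) (hm : 0 < m) (hjm : j + m ≤ p - 1) :
    lehmerSum p d r m - (bernoulliB p m j (1 : DirichletCharacter ℂ_[p] 1) -
      (r.totient : ℂ_[p])⁻¹ * ∑ f ∈ r.divisors,
        ∑ ψ : DirichletCharacter ℂ_[p] f with ψ.IsPrimitive, ψ⁻¹ (-((d * p : ℕ) : ZMod f)) *
          ∑ n ∈ Finset.range j, ∑ i ∈ Finset.Icc 1 j, (-1) ^ i * (j.choose i : ℂ_[p]) *
            lehmerTerm p r (d * p) m n i ψ) ∈ pPow p j := by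
  have h1 := lehmerSum_add_mem (p := p) d r hjm
  have h2 : ∑ i ∈ Finset.Icc 1 j, (-1) ^ i * (j.choose i : ℂ_[p]) *
      (∑ k ∈ Finset.Icc 1 (d * p / r), (k : ℂ_[p]) ^ (i * (p - 1) - m) -
      (-(genBernoulli (i * (p - 1) + 1 - m) (1 : DirichletCharacter ℂ_[p] 1) /
          ((i * (p - 1) + 1 - m : ℕ) : ℂ_[p])) +
        (r.totient : ℂ_[p])⁻¹ * ∑ f ∈ r.divisors,
          ∑ ψ : DirichletCharacter ℂ_[p] f with ψ.IsPrimitive,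
            ψ⁻¹ (-((d * p : ℕ) : ZMod f)) *
              ∑ n ∈ Finset.range j, lehmerTerm p r (d * p) m n i ψ)) ∈ pPow p j := by
    refine sum_mem fun i hi => mul_mem_pPow
      (mul_mem (pow_mem (neg_mem (one_mem _)) _) (natCast_mem _ _)) ?_
    have hi' := Finset.mem_Icc.1 hi
    exact sum_pow_sub_mem hr hφ hcop hm hjm hi'.1 hi'.2
  have h3 : ∑ f ∈ r.divisors, ∑ ψ : DirichletCharacter ℂ_[p] f with ψ.IsPrimitive,
        ψ⁻¹ (-((d * p : ℕ) : ZMod f)) *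
          ∑ n ∈ Finset.range j, ∑ i ∈ Finset.Icc 1 j, (-1) ^ i * (j.choose i : ℂ_[p]) *
            lehmerTerm p r (d * p) m n i ψ =
      ∑ i ∈ Finset.Icc 1 j, (-1) ^ i * (j.choose i : ℂ_[p]) * ∑ f ∈ r.divisors,
          ∑ ψ : DirichletCharacter ℂ_[p] f with ψ.IsPrimitive,
            ψ⁻¹ (-((d * p : ℕ) : ZMod f)) *
              ∑ n ∈ Finset.range j, lehmerTerm p r (d * p) m n i ψ := by
    simp_rw [Finset.mul_sum]
    rw [Finset.sum_comm (s := Finset.Icc 1 j)]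
    refine Finset.sum_congr rfl fun f _ => ?_
    rw [Finset.sum_comm (s := Finset.Icc 1 j)]
    refine Finset.sum_congr rfl fun ψ _ => ?_
    rw [Finset.sum_comm (s := Finset.Icc 1 j)]
    exact Finset.sum_congr rfl fun n _ => Finset.sum_congr rfl fun i _ => by ring
  convert sub_mem h1 h2 using 1
  rw [h3, bernoulliB, Finset.mul_sum]
  simp_rw [mul_sub, mul_add, Finset.sum_sub_distrib, Finset.sum_add_distrib, mul_neg,
    Finset.sum_neg_distrib]
  rw [Finset.sum_congr rfl fun i _ => mul_left_comm ((-1) ^ i * (j.choose i : ℂ_[p]))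
    (r.totient : ℂ_[p])⁻¹ _]
  ring

open Classical in
/-- The sum over the primitive characters and `n`, with the trivial character at `n = 0` split
off. -/
lemma sum_primitive_eq_add {M : Type*} [AddCommMonoid M] {r j : ℕ} (hr : r ≠ 0) (hj : 0 < j)
    (g : ℕ → (f : ℕ) → DirichletCharacter ℂ_[p] f → M) :
    ∑ f ∈ r.divisors, ∑ ψ : DirichletCharacter ℂ_[p] f with ψ.IsPrimitive,
        ∑ n ∈ Finset.range j, g n f ψ =
      g 0 1 1 + ∑ n ∈ Finset.range j, ∑ f ∈ r.divisors,
        ∑ ψ : DirichletCharacter ℂ_[p] f with ψ.IsPrimitive ∧ ¬(ψ = 1 ∧ n = 0), g n f ψ := by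
  have h1 : ∀ (n f : ℕ), ∑ ψ : DirichletCharacter ℂ_[p] f with ψ.IsPrimitive, g n f ψ =
      ∑ ψ : DirichletCharacter ℂ_[p] f with ψ.IsPrimitive ∧ (ψ = 1 ∧ n = 0), g n f ψ +
        ∑ ψ : DirichletCharacter ℂ_[p] f with ψ.IsPrimitive ∧ ¬(ψ = 1 ∧ n = 0), g n f ψ := by
    intro n f
    rw [← Finset.sum_filter_add_sum_filter_not (Finset.univ.filter fun ψ : DirichletCharacter ℂ_[p] f => ψ.IsPrimitive)
      (fun ψ => ψ = 1 ∧ n = 0), Finset.filter_filter, Finset.filter_filter]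
  have h2 : ∑ n ∈ Finset.range j, ∑ f ∈ r.divisors,
      ∑ ψ : DirichletCharacter ℂ_[p] f with ψ.IsPrimitive ∧ (ψ = 1 ∧ n = 0), g n f ψ =
      g 0 1 1 := by
    rw [Finset.sum_eq_single_of_mem 0 (Finset.mem_range.2 hj),
      Finset.sum_eq_single_of_mem 1 (Nat.one_mem_divisors.2 hr)]
    · refine (Finset.sum_congr (?_ : _ = ({1} : Finset (DirichletCharacter ℂ_[p] 1)))
        fun _ _ => rfl).trans (Finset.sum_singleton _ _)
      ext ψ
      simp only [Finset.mem_filter, Finset.mem_univ, true_and, and_true, Finset.mem_singleton]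
      exact ⟨fun h => h.2, fun h => ⟨h ▸ DirichletCharacter.isPrimitive_one_level_one, h⟩⟩
    · intro f hf hf1
      refine Finset.sum_eq_zero fun ψ hψ => absurd ?_ hf1
      have hψ' := (Finset.mem_filter.1 hψ).2
      have : NeZero f := ⟨ne_zero_of_dvd_ne_zero hr (Nat.dvd_of_mem_divisors hf)⟩
      exact eq_one_of_isPrimitive_one hψ'.1 hψ'.2.1
    · intro n _ hn
      refine Finset.sum_eq_zero fun f _ => Finset.sum_eq_zero fun ψ hψ => absurd ?_ hn
      exact (Finset.mem_filter.1 hψ).2.2.2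
  rw [← h2, ← Finset.sum_add_distrib]
  simp_rw [← Finset.sum_add_distrib, ← h1]
  rw [Finset.sum_comm]
  simp_rw [Finset.sum_comm (s := Finset.range j)]

end Assembly

/-! ### The cases `m = 1` and `m > 1` -/

section MainCases

lemma ringChoose_neg_one (n : ℕ) : Ring.choose (-1 : ℤ) n = (-1) ^ n := by
  rw [Ring.choose_neg]
  simp [Int.negOnePow_def, Units.smul_def, Ring.choose_natCast]

lemma not_dvd_sub_one_of_mem_primeFactors {p r q : ℕ} (hφ : ¬ p ∣ r.totient)
    (hq : q ∈ r.primeFactors) : ¬ p ∣ q - 1 := by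
  intro h
  rw [← Nat.totient_prime (Nat.prime_of_mem_primeFactors hq)] at h
  exact hφ (h.trans (Nat.totient_dvd_of_dvd (Nat.dvd_of_mem_primeFactors hq)))

variable {p : ℕ} [Fact p.Prime]

lemma bernoulliB_sub_mem {m j : ℕ} (hm : 2 ≤ m) (hj : 0 < j) (hjm : j + m ≤ p - 1) {X₀ : ℂ_[p]}
    (hX₀ : X₀ = bernoulliB p m j (1 : DirichletCharacter ℂ_[p] 1) ∨
      X₀ = bernoulliK p m j (1 : DirichletCharacter ℂ_[p] 1)) :
    bernoulliB p m j (1 : DirichletCharacter ℂ_[p] 1) - X₀ ∈ pPow p j := by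
  have hp : p.Prime := Fact.out
  obtain ⟨F, hF, hFi⟩ := exists_expCongr_genBernoulli_one hm hjm (p ^ j)
  have hjI : j ≤ p ^ j := (Nat.lt_pow_self hp.one_lt).le
  rcases hX₀ with rfl | rfl
  · simp
  · have h := sub_mem (bernoulliB_add_mem hF hFi hjI)
      (bernoulliK_add_mem hF hFi (Nat.pow_le_pow_right hp.pos (by omega)))
    convert h using 1
    ring

/-- For `m = 1` the trivial character at `n = 0` combines with the separate Bernoulli number to
`eulerDefect`. -/
lemma inv_totient_mul_lehmerTerm {r N i : ℕ} (hr : r ≠ 0) (hi : 1 ≤ i) (hp2 : 2 ≤ p - 1) :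
    (r.totient : ℂ_[p])⁻¹ * lehmerTerm p r N 1 0 i (1 : DirichletCharacter ℂ_[p] 1) =
      (eulerDefect ℂ_[p] r (i * (p - 1)) + 1) *
        (genBernoulli (i * (p - 1)) (1 : DirichletCharacter ℂ_[p] 1) /
          ((i * (p - 1) : ℕ) : ℂ_[p])) := by
  have hle := prime_sub_one_le_mul (p := p) hi
  have hrK : (r : ℂ_[p]) ≠ 0 := Nat.cast_ne_zero.2 hr
  obtain ⟨s, hs⟩ : ∃ s, i * (p - 1) = s + 1 := ⟨i * (p - 1) - 1, by omega⟩
  have htot : (r.totient : ℂ_[p]) = r * ∏ q ∈ r.primeFactors, (1 - (q : ℂ_[p])⁻¹) := by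
    have := congrArg (fun x : ℚ => (x : ℂ_[p])) (Nat.totient_eq_mul_prod_factors r)
    push_cast at this
    exact this
  have hE : eulerD (1 : DirichletCharacter ℂ_[p] 1) r (((s + 1 : ℕ) : ℤ) - 1) =
      ∏ q ∈ r.primeFactors, (1 - (q : ℂ_[p]) ^ s) := by
    rw [eulerD, Nat.div_one]
    refine Finset.prod_congr rfl fun q _ => ?_
    rw [MulChar.one_apply (isUnit_of_subsingleton _), one_mul, Nat.cast_succ, add_sub_cancel_right,
      zpow_natCast]
  have hP : ∏ q ∈ r.primeFactors, ((q : ℂ_[p]) - (q : ℂ_[p]) ^ (s + 1)) / ((q : ℂ_[p]) - 1) =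
      (∏ q ∈ r.primeFactors, (1 - (q : ℂ_[p])⁻¹))⁻¹ *
        ∏ q ∈ r.primeFactors, (1 - (q : ℂ_[p]) ^ s) := by
    rw [← Finset.prod_inv_distrib, ← Finset.prod_mul_distrib]
    refine Finset.prod_congr rfl fun q hq => ?_
    have hqp := Nat.prime_of_mem_primeFactors hq
    have hq0 : (q : ℂ_[p]) ≠ 0 := Nat.cast_ne_zero.2 hqp.ne_zero
    have hq1 : (q : ℂ_[p]) - 1 ≠ 0 := by rw [sub_ne_zero]; exact_mod_cast hqp.ne_one
    have hq2 : 1 - (q : ℂ_[p])⁻¹ ≠ 0 := by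
      rw [sub_ne_zero, ne_comm, Ne, inv_eq_one]; exact_mod_cast hqp.ne_one
    field_simp
    ring
  rw [lehmerTerm, eulerDefect, hs, show s + 1 + 1 - (1 + 0) = s + 1 by omega,
    show s + 1 - 1 = s by omega, hE, hP, htot]
  simp only [Nat.choose_zero_right, Nat.cast_one, mul_one, pow_zero, sub_add_cancel, mul_inv,
    pow_succ]
  ring

lemma congrModPow_lehmerRhs {d r m j : ℕ} (hr : ¬ p ∣ r) (hφ : ¬ p ∣ r.totient)
    (hcop : (d * p).Coprime r) (hm : 1 < m) (hj : 0 < j) (hjm : j + m ≤ p - 1) {X₀ : ℂ_[p]}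
    {X : ℕ → (f : ℕ) → DirichletCharacter ℂ_[p] f → ℂ_[p]}
    (hX₀ : X₀ = bernoulliB p m j (1 : DirichletCharacter ℂ_[p] 1) ∨
      X₀ = bernoulliK p m j (1 : DirichletCharacter ℂ_[p] 1))
    (hX : ∀ n < j, ∀ f ∈ r.divisors, ∀ ψ : DirichletCharacter ℂ_[p] f, ψ.IsPrimitive →
        X n f ψ = bernoulliB p (m + n) (j - n) ψ ∨ X n f ψ = bernoulliK p (m + n) (j - n) ψ) :
    CongrModPow p j (lehmerSum p d r m) (lehmerRhs p d r m j X₀ X) := by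
  classical
  have hr0 : r ≠ 0 := by rintro rfl; exact hr (dvd_zero p)
  have h1 := lehmerSum_sub_mem (p := p) (d := d) hr hφ hcop (by omega) hjm
  have h2 := bernoulliB_sub_mem hm hj hjm hX₀
  have h3 : (r.totient : ℂ_[p])⁻¹ * ∑ f ∈ r.divisors,
      ∑ ψ : DirichletCharacter ℂ_[p] f with ψ.IsPrimitive, ψ⁻¹ (-((d * p : ℕ) : ZMod f)) *
        ∑ n ∈ Finset.range j, (∑ i ∈ Finset.Icc 1 j, (-1) ^ i * (j.choose i : ℂ_[p]) *
          lehmerTerm p r (d * p) m n i ψ -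
        (r : ℂ_[p]) ^ m * ((Ring.choose (-(m : ℤ)) n : ℤ) : ℂ_[p]) * ((d * p : ℕ) : ℂ_[p]) ^ n *
          eulerD ψ r (-(m : ℤ) - n) * X n f ψ) ∈ pPow p j := by
    refine mul_mem_pPow (inv_natCast_mem_int hφ)
      (sum_mem fun f hf => sum_mem fun ψ hψ => mul_mem_pPow ?_ (sum_mem fun n hn => ?_))
    · have : NeZero f := ⟨ne_zero_of_dvd_ne_zero hr0 (Nat.dvd_of_mem_divisors hf)⟩
      exact dirichletCharacter_mem_int _ _
    · have hψ' := (Finset.mem_filter.1 hψ).2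
      have hn' := Finset.mem_range.1 hn
      exact sum_lehmerTerm_sub_mem hr (Nat.dvd_of_mem_divisors hf) hψ' (Or.inr (by omega)) hn' hjm
        (hX n hn' f hf ψ hψ')
  have h4 := sub_mem (add_mem h1 h2) h3
  change lehmerSum p d r m - lehmerRhs p d r m j X₀ X ∈ pPow p j
  convert h4 using 1
  simp_rw [Finset.sum_sub_distrib, mul_sub, Finset.sum_sub_distrib]
  have h5 : ∑ f ∈ r.divisors, ∑ ψ : DirichletCharacter ℂ_[p] f with ψ.IsPrimitive,
      ψ⁻¹ (-((d * p : ℕ) : ZMod f)) * ∑ n ∈ Finset.range j,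
        (r : ℂ_[p]) ^ m * ((Ring.choose (-(m : ℤ)) n : ℤ) : ℂ_[p]) * ((d * p : ℕ) : ℂ_[p]) ^ n *
          eulerD ψ r (-(m : ℤ) - n) * X n f ψ =
      (r : ℂ_[p]) ^ m * ∑ f ∈ r.divisors, ∑ ψ : DirichletCharacter ℂ_[p] f with ψ.IsPrimitive,
        ψ⁻¹ (-((d * p : ℕ) : ZMod f)) * ∑ n ∈ Finset.range j,
          ((Ring.choose (-(m : ℤ)) n : ℤ) : ℂ_[p]) * eulerD ψ r (-(m : ℤ) - n) * X n f ψ *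
            ((d * p : ℕ) : ℂ_[p]) ^ n := by
    simp_rw [Finset.mul_sum]
    exact Finset.sum_congr rfl fun f _ => Finset.sum_congr rfl fun ψ _ =>
      Finset.sum_congr rfl fun n _ => by ring
  rw [mul_sub, h5, lehmerRhs]
  ring

lemma congrModPow_lehmerRhsOne {d r j : ℕ} (hr : ¬ p ∣ r) (hφ : ¬ p ∣ r.totient)
    (hcop : (d * p).Coprime r) (hj : 0 < j) (hjm : j + 1 ≤ p - 1)
    {X : ℕ → (f : ℕ) → DirichletCharacter ℂ_[p] f → ℂ_[p]}
    (hX : ∀ n < j, ∀ f ∈ r.divisors, ∀ ψ : DirichletCharacter ℂ_[p] f, ψ.IsPrimitive →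
        X n f ψ = bernoulliB p (1 + n) (j - n) ψ ∨ X n f ψ = bernoulliK p (1 + n) (j - n) ψ) :
    CongrModPow p j (lehmerSum p d r 1) (lehmerRhsOne p d r j X) := by
  classical
  have hr0 : r ≠ 0 := by rintro rfl; exact hr (dvd_zero p)
  have h1 := lehmerSum_sub_mem (p := p) (d := d) hr hφ hcop one_pos hjm
  have h2 := sum_eulerDefect_sub_mem hr (fun q => not_dvd_sub_one_of_mem_primeFactors hφ) hj hjm
  have h3 : (r.totient : ℂ_[p])⁻¹ * ∑ n ∈ Finset.range j, ∑ f ∈ r.divisors,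
      ∑ ψ : DirichletCharacter ℂ_[p] f with ψ.IsPrimitive ∧ ¬(ψ = 1 ∧ n = 0),
        ψ⁻¹ (-((d * p : ℕ) : ZMod f)) *
        (∑ i ∈ Finset.Icc 1 j, (-1) ^ i * (j.choose i : ℂ_[p]) *
          lehmerTerm p r (d * p) 1 n i ψ -
        (r : ℂ_[p]) * (eulerD ψ r (-1 - (n : ℤ)) * X n f ψ *
            (-((d * p : ℕ) : ℂ_[p])) ^ n)) ∈ pPow p j := by
    refine mul_mem_pPow (inv_natCast_mem_int hφ) (sum_mem fun n hn => sum_mem fun f hf =>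
      sum_mem fun ψ hψ => mul_mem_pPow ?_ ?_)
    · have : NeZero f := ⟨ne_zero_of_dvd_ne_zero hr0 (Nat.dvd_of_mem_divisors hf)⟩
      exact dirichletCharacter_mem_int _ _
    · obtain ⟨hψ1, hψ2⟩ := (Finset.mem_filter.1 hψ).2
      have hn' := Finset.mem_range.1 hn
      have h := sum_lehmerTerm_sub_mem (d := d) hr (Nat.dvd_of_mem_divisors hf) hψ1
        (by by_cases h : ψ = 1 <;> [(right; grind); exact Or.inl h]) hn' hjm
        (hX n hn' f hf ψ hψ1)
      convert h using 2
      rw [Nat.cast_one, ringChoose_neg_one, neg_pow]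
      push_cast
      ring
  have h6 : (r.totient : ℂ_[p])⁻¹ * ∑ f ∈ r.divisors,
      ∑ ψ : DirichletCharacter ℂ_[p] f with ψ.IsPrimitive, ψ⁻¹ (-((d * p : ℕ) : ZMod f)) *
        ∑ n ∈ Finset.range j, ∑ i ∈ Finset.Icc 1 j, (-1) ^ i * (j.choose i : ℂ_[p]) *
          lehmerTerm p r (d * p) 1 n i ψ =
      (r.totient : ℂ_[p])⁻¹ * ∑ i ∈ Finset.Icc 1 j, (-1) ^ i * (j.choose i : ℂ_[p]) *
          lehmerTerm p r (d * p) 1 0 i (1 : DirichletCharacter ℂ_[p] 1) +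
      (r.totient : ℂ_[p])⁻¹ * ∑ n ∈ Finset.range j, ∑ f ∈ r.divisors,
      ∑ ψ : DirichletCharacter ℂ_[p] f with ψ.IsPrimitive ∧ ¬(ψ = 1 ∧ n = 0),
        ψ⁻¹ (-((d * p : ℕ) : ZMod f)) * ∑ i ∈ Finset.Icc 1 j, (-1) ^ i * (j.choose i : ℂ_[p]) *
          lehmerTerm p r (d * p) 1 n i ψ := by
    rw [← mul_add]
    congr 1
    have := sum_primitive_eq_add (p := p) hr0 hj fun n f ψ => ψ⁻¹ (-((d * p : ℕ) : ZMod f)) *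
      ∑ i ∈ Finset.Icc 1 j, (-1) ^ i * (j.choose i : ℂ_[p]) * lehmerTerm p r (d * p) 1 n i ψ
    simp_rw [Finset.mul_sum] at this ⊢
    rw [this, inv_one]
    simp_rw [MulChar.one_apply (isUnit_of_subsingleton _), one_mul]
  have h7 : (r.totient : ℂ_[p])⁻¹ * ∑ i ∈ Finset.Icc 1 j, (-1) ^ i * (j.choose i : ℂ_[p]) *
        lehmerTerm p r (d * p) 1 0 i (1 : DirichletCharacter ℂ_[p] 1) =
      bernoulliB p 1 j (1 : DirichletCharacter ℂ_[p] 1) +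
      ∑ i ∈ Finset.Icc 1 j, (-1) ^ i * (j.choose i : ℂ_[p]) *
        (eulerDefect ℂ_[p] r (i * (p - 1)) *
          (genBernoulli (i * (p - 1)) (1 : DirichletCharacter ℂ_[p] 1) /
            ((i * (p - 1) : ℕ) : ℂ_[p]))) := by
    rw [bernoulliB, ← Finset.sum_add_distrib, Finset.mul_sum]
    refine Finset.sum_congr rfl fun i hi => ?_
    rw [mul_left_comm, inv_totient_mul_lehmerTerm hr0 (Finset.mem_Icc.1 hi).1 (by omega),
      Nat.add_sub_cancel]
    ring
  have h4 := sub_mem (sub_mem h1 h2) h3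
  change lehmerSum p d r 1 - lehmerRhsOne p d r j X ∈ pPow p j
  convert h4 using 1
  rw [h6, h7]
  simp_rw [mul_sub, Finset.sum_sub_distrib]
  have h5 : ∑ n ∈ Finset.range j, ∑ f ∈ r.divisors,
      ∑ ψ : DirichletCharacter ℂ_[p] f with ψ.IsPrimitive ∧ ¬(ψ = 1 ∧ n = 0),
        ψ⁻¹ (-((d * p : ℕ) : ZMod f)) * ((r : ℂ_[p]) *
          (eulerD ψ r (-1 - (n : ℤ)) * X n f ψ * (-((d * p : ℕ) : ℂ_[p])) ^ n)) =
      (r : ℂ_[p]) * ∑ n ∈ Finset.range j, ∑ f ∈ r.divisors,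
        ∑ ψ : DirichletCharacter ℂ_[p] f with ψ.IsPrimitive ∧ ¬(ψ = 1 ∧ n = 0),
          ψ⁻¹ (-((d * p : ℕ) : ZMod f)) * eulerD ψ r (-1 - (n : ℤ)) * X n f ψ *
            (-((d * p : ℕ) : ℂ_[p])) ^ n := by
    simp_rw [Finset.mul_sum]
    exact Finset.sum_congr rfl fun n _ => Finset.sum_congr rfl fun f _ =>
      Finset.sum_congr rfl fun ψ _ => by ring
  rw [mul_sub, h5, lehmerRhsOne]
  ring

end MainCases

theorem mainTheorem2 (p : ℕ) [Fact p.Prime] (hp : p ≠ 2) (d r m j : ℕ)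
    (hd : 0 < d) (hr : 0 < r) (hm : 0 < m) (hj : 0 < j)
    (hrdp : r.Coprime (d * p)) (hφ : r.totient.Coprime p) (hjm : j + m ≤ p - 1) :
    -- the congruence for `m = 1`
    (m = 1 → CongrModPow p j (lehmerSum p d r 1)
      (lehmerRhsOne p d r j fun n _ ψ => bernoulliB p (1 + n) (j - n) ψ)) ∧
    -- the congruence for `m > 1`
    (1 < m → CongrModPow p j (lehmerSum p d r m)
      (lehmerRhs p d r m j (bernoulliB p m j (1 : DirichletCharacter ℂ_[p] 1))
        fun n _ ψ => bernoulliB p (m + n) (j - n) ψ)) ∧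
    -- any selection of the quantities `B_p` may be replaced, independently of each other
    (∀ (X₀ : ℂ_[p]) (X : ℕ → (f : ℕ) → DirichletCharacter ℂ_[p] f → ℂ_[p]),
      (X₀ = bernoulliB p m j (1 : DirichletCharacter ℂ_[p] 1) ∨
        X₀ = bernoulliK p m j (1 : DirichletCharacter ℂ_[p] 1)) →
      (∀ n < j, ∀ f ∈ r.divisors, ∀ ψ : DirichletCharacter ℂ_[p] f, ψ.IsPrimitive →
        X n f ψ = bernoulliB p (m + n) (j - n) ψ ∨ X n f ψ = bernoulliK p (m + n) (j - n) ψ) →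
      (m = 1 → CongrModPow p j (lehmerSum p d r 1) (lehmerRhsOne p d r j X)) ∧
      (1 < m → CongrModPow p j (lehmerSum p d r m) (lehmerRhs p d r m j X₀ X))) := by
  have hpp : p.Prime := Fact.out
  have hrp : ¬ p ∣ r := (Nat.Prime.coprime_iff_not_dvd hpp).1 (hrdp.coprime_mul_left_right).symm
  have hφp : ¬ p ∣ r.totient := (Nat.Prime.coprime_iff_not_dvd hpp).1 hφ.symm
  refine ⟨?_, fun hm1 => congrModPow_lehmerRhs hrp hφp hrdp.symm hm1 hj hjm (Or.inl rfl)
    fun _ _ _ _ _ _ => Or.inl rfl, fun X₀ X hX₀ hX => ⟨?_, fun hm1 =>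
      congrModPow_lehmerRhs hrp hφp hrdp.symm hm1 hj hjm hX₀ hX⟩⟩
  · rintro rfl
    exact congrModPow_lehmerRhsOne hrp hφp hrdp.symm hj hjm fun _ _ _ _ _ _ => Or.inl rfl
  · rintro rfl
    exact congrModPow_lehmerRhsOne hrp hφp hrdp.symm hj hjm hX
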